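/- Let $n\ge 1$ be an integer and $\gamma$ an ordinal. For $\alpha<\gamma$ write $[\alpha,\gamma)=\{\xi\mid\alpha\le\xi<\gamma\}$, and for a set $A$ of ordinals write $[A]^m$ for the collection of its $m$-element subsets. For $m\geq 0$ let $P_m(A)=\bigoplus_{[A]^{m+1}}\mathbb{Z}$, with generators $\langle\vec\alpha\rangle$, $\vec\alpha=(\alpha_0<\dots<\alpha_m)$, and let $d_m:P_m(A)\to P_{m-1}(A)$ (for $m\ge1$) be given by $d_m\langle\vec\alpha\rangle=\sum_{i\le m}(-1)^i\langle\vec\alpha^i\rangle$, where $\vec\alpha^i$ omits $\alpha_i$. Let $\mathbf{d}_n\mathbf{P}_n(\gamma)$ be the inverse system of abelian groups indexed by $\alpha\in\gamma$ with terms $d_nP_n([\alpha,\gamma))\subseteq P_{n-1}([\alpha,\gamma))$ and the inclusions (for $\alpha\le\beta$, from the $\beta$-th to the $\alpha$-th term) as bonding maps. A basis of an inverse system $(X_\alpha,q_{\alpha\beta},\gamma)$ of abelian groups is a subset $\mathcal{B}$ of the disjoint union $\bigsqcup_{\alpha<\gamma}X_\alpha$ such that every element $x$ of every $X_\alpha$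 has a unique expression $x=\sum_{i<k}a_i\,q_{\alpha\beta_i}(b_i)$ with distinct $b_i\in\mathcal{B}\cap X_{\beta_i}$, $\beta_i\ge\alpha$, and nonzero integers $a_i$. The system is free if it has a basis. For $B\subseteq[\gamma]^{n+1}$ let $d_n\mathcal{B}=\{d_n\langle\vec\alpha\rangle\mid\vec\alpha\in B\}$, where $d_n\langle\vec\alpha\rangle$ is regarded as an element of the term $d_nP_n([\alpha_0,\gamma))$. A simplicial complex on $\gamma$ is a downward-closed collection $G$ of nonempty finite subsets of $\gamma$ (its faces) containing every singleton; $G^m$ denotes the set of its faces with $m+1$ elements. It is $n$-dimensional if $G^m=\varnothing$ for all $m>n$ and, in case $\gamma$ has at least $n+1$ elements, $G^n\neq\varnothing$. An $n$-dimensional complex $G$ on $\gamma$ is tail-acyclic if $G^{n-1}=[\gamma]^n$ and, for all $\alpha<\gamma$ and $k\ge0$, the $k$-th reduced simplicial homology group $\tilde{\mathrm H}{}^{\Delta}_k$ (with integer coefficients) of the complex of those faces of $G$ that are contained in $[\alpha,\gamma)$ is zero. Then: (1) $\mathbf{d}_n\mathbf{P}_n(\gamma)$ is free if and only if there is a tail-acyclic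 $n$-dimensional simplicial complex on $\gamma$. (2) If $G$ is a tail-acyclic $n$-dimensional simplicial complex on $\gamma$ and $B=G^n$, then $d_n\mathcal{B}$ is a basis of $\mathbf{d}_n\mathbf{P}_n(\gamma)$. (3) Conversely, if $B\subseteq[\gamma]^{n+1}$ is such that $d_n\mathcal{B}$ is a basis of $\mathbf{d}_n\mathbf{P}_n(\gamma)$, then there is a tail-acyclic $n$-dimensional simplicial complex $G$ on $\gamma$ with $G^n=B$; moreover, if $\gamma>n$, such a $G$ is the collection of all nonempty subsets of elements of $B$. -/

import Mathlib

open CategoryTheory Opposite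

universe u

namespace TailAcyclic

universe v w

/-! ### Simplicial chains and reduced homology -/

section Chains

variable {V : Type v}

/-- The restriction of a complex to a set `A` of vertices: those faces that are contained
in `A`. -/
def restrict (K : PreAbstractSimplicialComplex V) (A : Set V) :
    PreAbstractSimplicialComplex V where
  faces := {s | s ∈ K.faces ∧ (s : Set V) ⊆ A}
  isRelLowerSet_faces := by
    rintro s ⟨hs, hA⟩
    refine ⟨(K.isRelLowerSet_faces hs).1, fun t hts ht => ⟨?_, ?_⟩⟩
    · exact (K.isRelLowerSet_faces hs).2 hts ht
    · exact (Finset.coe_subset.mpr hts).trans hA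

/-- The faces of `K` with exactly `m` vertices, i.e. those of dimension `m - 1`, where the
empty set is counted as the unique face of dimension `-1`. -/
def Face (K : PreAbstractSimplicialComplex V) (m : ℕ) : Type v :=
  {s : Finset V // s.card = m ∧ (s = ∅ ∨ s ∈ K.faces)}

/-- The group of simplicial chains of dimension `m - 1`: the free abelian group on the faces
with `m` vertices. Thus `C_n(K)` is `Chains K (n + 1)`, and `C_{-1}(K) = Chains K 0` is a copy
of `ℤ`. -/
abbrev Chains (K : PreAbstractSimplicialComplex V) (m : ℕ) : Type v := Face K m →₀ ℤ

variable [LinearOrder V]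

/-- The face obtained from `s` by omitting its vertex `x`. -/
def Face.erase {K : PreAbstractSimplicialComplex V} {m : ℕ} (s : Face K (m + 1))
    (x : {x : V // x ∈ s.1}) : Face K m :=
  ⟨s.1.erase x.1, by
    refine ⟨?_, ?_⟩
    · rw [Finset.card_erase_of_mem x.2, s.2.1]; rfl
    · rcases Finset.eq_empty_or_nonempty (s.1.erase x.1) with h | h
      · exact Or.inl h
      · refine Or.inr ?_
        rcases s.2.2 with h0 | hs
        · exact absurd x.2 (by simp [h0])
        · exact (K.isRelLowerSet_faces hs).2 (Finset.erase_subset _ _) h⟩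

/-- The boundary map `⟨s⟩ ↦ ∑ i, (-1) ^ i ⟨s with its i-th vertex omitted⟩`; the index of
the vertex `x` of `s` is the number of vertices of `s` below `x`. In terms of dimensions
`boundary K n` is `∂_n : C_n(K) → C_{n-1}(K)`, and `boundary K 0` is the augmentation. -/
noncomputable def boundary (K : PreAbstractSimplicialComplex V) (m : ℕ) :
    Chains K (m + 1) →ₗ[ℤ] Chains K m :=
  Finsupp.linearCombination ℤ fun s : Face K (m + 1) =>
    ∑ x ∈ s.1.attach,
      (-1 : ℤ) ^ (s.1.filter (fun y => y < x.1)).card • Finsupp.single (s.erase x) (1 : ℤ)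

/-- The `k`-th reduced simplicial homology group `ker ∂_k / im ∂_{k+1}`. -/
abbrev ReducedHomology (K : PreAbstractSimplicialComplex V) (k : ℕ) : Type v :=
  LinearMap.ker (boundary K k) ⧸
    (LinearMap.range (boundary K (k + 1))).submoduleOf (LinearMap.ker (boundary K k))

end Chains

/-! ### Functoriality of chains for inclusions of complexes -/

section Inclusion

variable {V : Type v} {K L M : PreAbstractSimplicialComplex V}

/-- A face of `K` as a face of a larger complex `L`. -/
def Face.incl (h : K ≤ L) {m : ℕ} (s : Face K m) : Face L m :=
  ⟨s.1, s.2.1, s.2.2.imp id (fun hs => h hs)⟩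

/-- The inclusion of chain groups induced by an inclusion of complexes. -/
noncomputable def chainsIncl (h : K ≤ L) (m : ℕ) : Chains K m →ₗ[ℤ] Chains L m :=
  Finsupp.lmapDomain ℤ ℤ (Face.incl h)

theorem chainsIncl_refl (m : ℕ) : chainsIncl (le_refl K) m = LinearMap.id :=
  Finsupp.lmapDomain_id ℤ ℤ

theorem chainsIncl_trans (h : K ≤ L) (h' : L ≤ M) (m : ℕ) :
    chainsIncl (h.trans h') m = chainsIncl h' m ∘ₗ chainsIncl h m :=
  Finsupp.lmapDomain_comp ℤ ℤ (Face.incl h) (Face.incl h')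

theorem boundary_chainsIncl [LinearOrder V] (h : K ≤ L) (m : ℕ) :
    boundary L m ∘ₗ chainsIncl h (m + 1) = chainsIncl h m ∘ₗ boundary K m := by
  refine Finsupp.lhom_ext' fun s => LinearMap.ext_ring ?_
  simp only [LinearMap.comp_apply, Finsupp.lsingle_apply, chainsIncl, boundary,
    Finsupp.lmapDomain_apply, Finsupp.mapDomain_single, Finsupp.linearCombination_single,
    one_smul]
  rw [Finsupp.mapDomain_finsetSum]
  refine Finset.sum_congr rfl fun x _ => ?_
  rw [Finsupp.mapDomain_smul, Finsupp.mapDomain_single]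
  rfl

end Inclusion

/-! ### Inverse systems of abelian groups

An inverse system over a preorder `I` is a functor from `Iᵒᵖ` to abelian groups. -/

section Systems

variable {I : Type v} [Preorder I]

/-- `B`, a subset of the disjoint union of the terms of the inverse system `X`, is a basis
of `X` if every `x` in every term `X i` has a unique decomposition as a finite sum
`∑ b, c b • q b`, with integer coefficients `c b`, where `b` runs over those elements of `B`
that lie in some term `X j` with `i ≤ j`, and `q : X j → X i` is the bonding map. -/
def IsBasis (X : Iᵒᵖ ⥤ AddCommGrpCat.{w}) (B : Set (Σ i : I, X.obj (op i))) : Prop :=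
  ∀ (i : I) (x : X.obj (op i)), ∃! c : {b : Σ j : I, X.obj (op j) // b ∈ B ∧ i ≤ b.1} →₀ ℤ,
    x = c.sum fun b a => a • (X.map (homOfLE b.2.2).op).hom b.1.2

/-- An inverse system of abelian groups is free if it has a basis. -/
def IsFree (X : Iᵒᵖ ⥤ AddCommGrpCat.{w}) : Prop :=
  ∃ B : Set (Σ i : I, X.obj (op i)), IsBasis X B

/-- The (termwise) image of a morphism of inverse systems, as a subsystem of its target. -/
def imageSystem {X Y : Iᵒᵖ ⥤ AddCommGrpCat.{w}} (f : X ⟶ Y) : Iᵒᵖ ⥤ AddCommGrpCat.{w} where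
  obj i := AddCommGrpCat.of (f.app i).hom.range
  map {i j} g := AddCommGrpCat.ofHom
    (((Y.map g).hom.comp (f.app i).hom.range.subtype).codRestrict (f.app j).hom.range (by
      rintro ⟨_, x, rfl⟩
      refine ⟨(X.map g).hom x, ?_⟩
      exact ConcreteCategory.congr_hom (f.naturality g) x))
  map_id i := by
    ext x
    change (Y.map (𝟙 i)).hom x.1 = x.1
    simp
  map_comp {i j k} g h := by
    ext x
    change (Y.map (g ≫ h)).hom x.1 = (Y.map h).hom ((Y.map g).hom x.1)
    simp

end Systems

/-! ### The systems `P_n` and `d_n P_n` -/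

section ChainSystems

variable (V : Type v) [LinearOrder V]

/-- The complete simplicial complex on the tail `[α, →)` of `V`. -/
def tail {V : Type v} [LinearOrder V] (α : V) : PreAbstractSimplicialComplex V :=
  restrict ⊤ (Set.Ici α)

theorem tail_antitone {V : Type v} [LinearOrder V] {α β : V} (h : α ≤ β) :
    tail β ≤ tail α :=
  fun _ hs => ⟨hs.1, hs.2.trans (Set.Ici_subset_Ici.mpr h)⟩

/-- The inverse system `α ↦ C_{m-1}([α, →))` of the chain groups of the complete complexes on
the tails of `V`, with the inclusions as bonding maps. Thus `P_n`, with
`P_n([α, →)) = ⨁_{[[α, →)]^{n+1}} ℤ`, is `chainSystem V (n + 1)`. -/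
noncomputable def chainSystem (m : ℕ) : Vᵒᵖ ⥤ AddCommGrpCat.{v} where
  obj α := AddCommGrpCat.of (Chains (tail α.unop) m)
  map {_ _} g :=
    AddCommGrpCat.ofHom (chainsIncl (tail_antitone g.unop.le) m).toAddMonoidHom
  map_id α := by
    rw [chainsIncl_refl]; rfl
  map_comp {α β δ} g h := by
    rw [chainsIncl_trans (tail_antitone g.unop.le) (tail_antitone h.unop.le)]; rfl

/-- The system `P_n`. -/
noncomputable abbrev P (n : ℕ) : Vᵒᵖ ⥤ AddCommGrpCat.{v} := chainSystem V (n + 1)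

/-- The morphism of systems `d_n : P_n → P_{n-1}` given by the boundary maps (for `n = 0`
it is the augmentation onto the constant system `ℤ`). -/
noncomputable def d (n : ℕ) : P V n ⟶ chainSystem V n where
  app α := AddCommGrpCat.ofHom (boundary (tail α.unop) n).toAddMonoidHom
  naturality {α β} g := by
    ext x
    exact LinearMap.congr_fun (boundary_chainsIncl (tail_antitone g.unop.le) n) x

/-- The system `d_n P_n`. -/
noncomputable def dP (n : ℕ) : Vᵒᵖ ⥤ AddCommGrpCat.{v} := imageSystem (d V n)

variable {V}

/-- A nonempty finite set, as a face of the complete complex on the tail of `V` that starts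
at its least element. -/
def topFace {n : ℕ} (s : {s : Finset V // s.card = n + 1}) :
    Face (tail (s.1.min' (Finset.card_pos.mp (by rw [s.2]; exact n.succ_pos)))) (n + 1) :=
  ⟨s.1, s.2, Or.inr ⟨Finset.card_pos.mp (by rw [s.2]; exact n.succ_pos),
    fun x hx => s.1.min'_le x hx⟩⟩

/-- The element `d_n ⟨s⟩` of the system `d_n P_n`, taken in the highest possible term, the one
indexed by the least element of `s`. -/
noncomputable def dGen (n : ℕ) (s : {s : Finset V // s.card = n + 1}) :
    Σ α : V, (dP V n).obj (op α) :=
  ⟨s.1.min' (Finset.card_pos.mp (by rw [s.2]; exact n.succ_pos)),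
    ⟨boundary _ n (Finsupp.single (topFace s) 1), ⟨Finsupp.single (topFace s) 1, rfl⟩⟩⟩

end ChainSystems

/-! ### Tail-acyclic complexes -/

section TailAcyclicComplexes

variable {V : Type v}

/-- The set of `n`-dimensional faces of a complex. -/
def nFaces (n : ℕ) (G : AbstractSimplicialComplex V) : Set {s : Finset V // s.card = n + 1} :=
  {s | s.1 ∈ G.faces}

/-- `G` is `n`-dimensional: no face has dimension above `n`, and there is a face of dimension
`n`, except that the latter is not required if there are at most `n` vertices (so that there is
no candidate for such a face). -/
def IsNDimensional (n : ℕ) (G : AbstractSimplicialComplex V) : Prop :=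
  (∀ s ∈ G.faces, s.card ≤ n + 1) ∧
    (Nonempty {s : Finset V // s.card = n + 1} → (nFaces n G).Nonempty)

/-- `G` is a tail-acyclic `n`-dimensional simplicial complex: it is `n`-dimensional, every set of
`n` vertices is a face, and its restriction to every tail `[α, →)` has vanishing reduced
homology. -/
structure IsTailAcyclic [LinearOrder V] (n : ℕ) (G : AbstractSimplicialComplex V) : Prop where
  dim : IsNDimensional n G
  complete : ∀ s : Finset V, s.card = n → s ∈ G.faces
  acyclic : ∀ (α : V) (k : ℕ),
    Subsingleton (ReducedHomology (restrict G.toPreAbstractSimplicialComplex (Set.Ici α)) k)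

end TailAcyclicComplexes

end TailAcyclic

/-! Parts (2) and (3) are a translation. Since `B` contains no simplex of dimension above `n`, the
vanishing of homology in degree `n` on every tail says that the boundaries of `B` are linearly
independent. Since all `n`-element sets are faces, vanishing in degree `n - 1` says that on each
tail these boundaries generate the boundaries of all `n`-simplices. Lower degrees are automatic,
because the complete complex on a tail is a cone. `IsTailBasis` records the common content.

The hard direction of (1) starts from an arbitrary basis, whose elements need not be boundaries of
single simplices. That basis is used only to obtain a section of `d_n` that respects tails
(`exists_isTailSplitting_of_isFree`). The link to complexes is a bound on cofinality. A set `X` with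
a splitting in dimension `n` has a cofinal subset of size less than `ℵ_n`
(`IsTailSplitting.exists_cofinal`). Otherwise some `Z` of cofinality `ℵ_(n-1)`, invariant under the
splitting, is bounded in `X`, and coning with a bound yields a splitting of `Z` in dimension `n -
1`, against the inductive bound. Conversely, such a cofinal subset allows a tail basis consisting of
simplices to be built by induction on `n` (`exists_isTailBasis`): `X` is well-ordered suitably and
bases over initial segments are coned and glued (`isTailBasis_glue`). -/

namespace TailAcyclic

/-! ### Linear maps on supported chains, checked on generators -/

section Simplices

universe v

variable {V : Type v}

/-- The finite subsets of `X` with exactly `m` elements. -/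
def simplices (X : Set V) (m : ℕ) : Set (Finset V) := {s | s.card = m ∧ (s : Set V) ⊆ X}

theorem simplices_mono {X Y : Set V} (h : X ⊆ Y) (m : ℕ) : simplices X m ⊆ simplices Y m :=
  fun _ hs => ⟨hs.1, hs.2.trans h⟩

theorem map_mem_of_single {α : Type*} {M : Type*} [AddCommGroup M] {S : Set α}
    (N : Submodule ℤ M) (f : (α →₀ ℤ) →ₗ[ℤ] M) (h : ∀ s ∈ S, f (Finsupp.single s 1) ∈ N)
    {z : α →₀ ℤ} (hz : z ∈ Finsupp.supported ℤ ℤ S) : f z ∈ N := by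
  have : Finsupp.supported ℤ ℤ S ≤ N.comap f := by
    rw [Finsupp.supported_eq_span_single, Submodule.span_le]
    rintro _ ⟨s, hs, rfl⟩
    exact h s hs
  exact this hz

theorem map_eq_of_single {α : Type*} {M : Type*} [AddCommGroup M] {S : Set α}
    (f g : (α →₀ ℤ) →ₗ[ℤ] M) (h : ∀ s ∈ S, f (Finsupp.single s 1) = g (Finsupp.single s 1))
    {z : α →₀ ℤ} (hz : z ∈ Finsupp.supported ℤ ℤ S) : f z = g z := by
  have := map_mem_of_single (⊥ : Submodule ℤ M) (f - g) (S := S)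
    (fun s hs => by simp [h s hs]) hz
  simpa [sub_eq_zero] using this

theorem single_mem {α : Type*} {S : Set α} {s : α} (h : s ∈ S) :
    Finsupp.single s (1 : ℤ) ∈ Finsupp.supported ℤ ℤ S :=
  Finsupp.single_mem_supported ℤ 1 h

end Simplices

/-! ### Boundary and cone operators on chains of all finite subsets -/

section FullChains

universe v

variable {V : Type v} [LinearOrder V]

/-- The sign attached to the vertex `x` relative to the simplex `s`. -/
def sgn (x : V) (s : Finset V) : ℤ := (-1) ^ (s.filter (fun y => y < x)).card

theorem sgn_mul_self (x : V) (s : Finset V) : sgn x s * sgn x s = 1 := by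
  rw [sgn, ← mul_pow]; simp

theorem sgn_ne_zero (x : V) (s : Finset V) : sgn x s ≠ 0 := by simp [sgn]

theorem sgn_insert_of_not_lt {x y : V} (h : ¬ y < x) (s : Finset V) :
    sgn x (insert y s) = sgn x s := by
  simp [sgn, Finset.filter_insert, h]

theorem sgn_insert_of_lt {x y : V} (h : y < x) {s : Finset V} (hy : y ∉ s) :
    sgn x (insert y s) = -sgn x s := by
  simp [sgn, Finset.filter_insert, h, hy, pow_succ]

theorem sgn_erase_self (x : V) (s : Finset V) : sgn x (s.erase x) = sgn x s := by
  by_cases hx : x ∈ s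
  · conv_rhs => rw [← Finset.insert_erase hx]
    rw [sgn_insert_of_not_lt (lt_irrefl x)]
  · rw [Finset.erase_eq_of_notMem hx]

/-- The sign rule that cancels the cross terms in the homotopy formula `bd_cone_single`. -/
theorem sgn_swap {x y : V} (hxy : x ≠ y) {s : Finset V} (hx : x ∉ s) (hy : y ∈ s) :
    sgn x s * sgn y (insert x s) = -(sgn y s * sgn x (s.erase y)) := by
  have h := Finset.insert_erase hy
  rcases lt_or_gt_of_ne hxy with h1 | h1
  · have h2 : sgn x s = sgn x (s.erase y) := by
      conv_lhs => rw [← h]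
      rw [sgn_insert_of_not_lt h1.not_gt]
    rw [sgn_insert_of_lt h1 hx, h2]; ring
  · have h2 : sgn x s = -sgn x (s.erase y) := by
      conv_lhs => rw [← h]
      rw [sgn_insert_of_lt h1 (Finset.notMem_erase _ _)]
    rw [sgn_insert_of_not_lt h1.not_gt, h2]; ring

variable (V) in
/-- The boundary map on the free abelian group on all finite subsets of `V`. -/
noncomputable def bd : (Finset V →₀ ℤ) →ₗ[ℤ] (Finset V →₀ ℤ) :=
  Finsupp.linearCombination ℤ fun s => ∑ x ∈ s, sgn x s • Finsupp.single (s.erase x) (1 : ℤ)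

/-- The cone operator with apex `x`. -/
noncomputable def cone (x : V) : (Finset V →₀ ℤ) →ₗ[ℤ] (Finset V →₀ ℤ) :=
  Finsupp.linearCombination ℤ fun s =>
    if x ∈ s then 0 else sgn x s • Finsupp.single (insert x s) (1 : ℤ)

theorem bd_single (s : Finset V) : bd V (Finsupp.single s 1) =
    ∑ x ∈ s, sgn x s • Finsupp.single (s.erase x) (1 : ℤ) := by
  simp [bd]

theorem cone_single_of_mem {x : V} {s : Finset V} (h : x ∈ s) :
    cone x (Finsupp.single s 1) = 0 := by
  simp [cone, h]

theorem cone_single_of_notMem {x : V} {s : Finset V} (h : x ∉ s) :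
    cone x (Finsupp.single s 1) = sgn x s • Finsupp.single (insert x s) (1 : ℤ) := by
  simp [cone, h]

theorem single_eq_cone {x : V} {s : Finset V} (h : x ∈ s) :
    Finsupp.single s (1 : ℤ) = cone x (sgn x s • Finsupp.single (s.erase x) 1) := by
  rw [map_smul, cone_single_of_notMem (Finset.notMem_erase _ _), Finset.insert_erase h,
    sgn_erase_self, smul_smul, sgn_mul_self, one_smul]

/-- This makes `cone x` a contracting homotopy. If `x ∈ s`, only the face omitting `x` survives
coning; otherwise the faces containing `x` cancel by `sgn_swap`. -/
theorem bd_cone_single (x : V) (s : Finset V) :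
    bd V (cone x (Finsupp.single s 1)) + cone x (bd V (Finsupp.single s 1)) =
      Finsupp.single s 1 := by
  by_cases hx : x ∈ s
  · rw [cone_single_of_mem hx, map_zero, zero_add, bd_single, map_sum,
      Finset.sum_eq_single_of_mem x hx]
    · exact (single_eq_cone hx).symm
    · intro y hy hyx
      rw [map_smul, cone_single_of_mem (Finset.mem_erase.2 ⟨hyx.symm, hx⟩), smul_zero]
  · rw [cone_single_of_notMem hx, map_smul, bd_single, bd_single, Finset.sum_insert hx, smul_add,
      Finset.erase_insert hx, sgn_insert_of_not_lt (lt_irrefl x), smul_smul, sgn_mul_self,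
      one_smul, add_assoc, map_sum, Finset.smul_sum, ← Finset.sum_add_distrib,
      Finset.sum_eq_zero, add_zero]
    intro y hy
    have hxy : x ≠ y := fun h => hx (h ▸ hy)
    have hx' : x ∉ s.erase y := fun h => hx (Finset.mem_of_mem_erase h)
    rw [map_smul, cone_single_of_notMem hx', smul_smul, smul_smul, sgn_swap hxy hx hy,
      Finset.erase_insert_of_ne hxy]
    simp

theorem bd_cone (x : V) (z : Finset V →₀ ℤ) : bd V (cone x z) = z - cone x (bd V z) := by
  rw [eq_sub_iff_add_eq]
  exact map_eq_of_single (S := Set.univ) (bd V ∘ₗ cone x + cone x ∘ₗ bd V) LinearMap.id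
    (fun s _ => bd_cone_single x s) (by simp [Finsupp.supported_univ])

theorem bd_bd (z : Finset V →₀ ℤ) : bd V (bd V z) = 0 := by
  refine map_eq_of_single (S := Set.univ) (bd V ∘ₗ bd V) 0 (fun s _ => ?_)
    (by simp [Finsupp.supported_univ])
  induction s using Finset.induction_on with
  | empty => simp [bd_single]
  | insert x s hx ih =>
    -- A nonempty simplex is, up to sign, the cone over a smaller one, so two uses of the homotopy
    -- formula reduce the claim to the inductive hypothesis.
    rw [single_eq_cone (Finset.mem_insert_self x s), Finset.erase_insert hx, map_smul, map_smul]
    replace ih := ih (Set.mem_univ _)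
    simp only [LinearMap.comp_apply, LinearMap.zero_apply] at ih ⊢
    rw [bd_cone, map_sub, bd_cone, ih]
    simp

theorem bd_mem {X : Set V} {m : ℕ} {z : Finset V →₀ ℤ}
    (hz : z ∈ Finsupp.supported ℤ ℤ (simplices X (m + 1))) :
    bd V z ∈ Finsupp.supported ℤ ℤ (simplices X m) := by
  refine map_mem_of_single _ (bd V) (fun s hs => ?_) hz
  rw [bd_single]
  refine Submodule.sum_mem _ fun x hx => Submodule.smul_mem _ _ (single_mem ⟨?_, ?_⟩)
  · rw [Finset.card_erase_of_mem hx, hs.1]; rfl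
  · exact (Finset.coe_subset.2 (Finset.erase_subset _ _)).trans hs.2

theorem cone_mem {X : Set V} {x : V} (hx : x ∈ X) {m : ℕ} {z : Finset V →₀ ℤ}
    (hz : z ∈ Finsupp.supported ℤ ℤ (simplices X m)) :
    cone x z ∈ Finsupp.supported ℤ ℤ (simplices X (m + 1)) := by
  refine map_mem_of_single _ (cone x) (fun s hs => ?_) hz
  by_cases h : x ∈ s
  · simp [cone_single_of_mem h]
  · rw [cone_single_of_notMem h]
    refine Submodule.smul_mem _ _ (single_mem ⟨?_, ?_⟩)
    · rw [Finset.card_insert_of_notMem h, hs.1]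
    · rw [Finset.coe_insert]; exact Set.insert_subset hx hs.2

/-- The complete complex on a set is acyclic in the degrees where a cycle involves a vertex. -/
theorem exists_bd_eq {X : Set V} {m : ℕ} {z : Finset V →₀ ℤ}
    (hz : z ∈ Finsupp.supported ℤ ℤ (simplices X (m + 1))) (h0 : bd V z = 0) :
    ∃ w ∈ Finsupp.supported ℤ ℤ (simplices X (m + 2)), bd V w = z := by
  rcases X.eq_empty_or_nonempty with rfl | ⟨x, hx⟩
  · refine ⟨0, Submodule.zero_mem _, ?_⟩
    have : simplices (∅ : Set V) (m + 1) = ∅ := by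
      ext s
      simp only [simplices, Set.mem_ofPred_eq, Set.subset_empty_iff, Finset.coe_eq_empty,
        Set.mem_empty_iff_false, iff_false, not_and]
      rintro h rfl
      simp at h
    rw [this, Finsupp.supported_empty, Submodule.mem_bot] at hz
    rw [hz, map_zero]
  · exact ⟨cone x z, cone_mem hx hz, by rw [bd_cone, h0, map_zero, sub_zero]⟩

theorem bd_single_apply_erase {s : Finset V} {x : V} (hx : x ∈ s) :
    bd V (Finsupp.single s 1) (s.erase x) = sgn x s := by
  rw [bd_single, Finsupp.finsetSum_apply, Finset.sum_eq_single_of_mem x hx]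
  · simp
  · intro y hy hyx
    rw [Finsupp.smul_apply, Finsupp.single_apply, if_neg, smul_zero]
    intro h
    have : x ∈ s.erase y := Finset.mem_erase.2 ⟨hyx.symm, hx⟩
    rw [h] at this
    exact Finset.notMem_erase _ _ this

theorem exists_subset_of_bd_apply_ne_zero {S : Set (Finset V)} {w : Finset V →₀ ℤ}
    (hw : w ∈ Finsupp.supported ℤ ℤ S) {t : Finset V} (h : bd V w t ≠ 0) :
    ∃ s ∈ S, t ⊆ s := by
  by_contra! hS
  refine h ?_
  refine map_eq_of_single (Finsupp.lapply t ∘ₗ bd V) 0 (fun s hs => ?_) hw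
  rw [LinearMap.comp_apply, bd_single, map_sum]
  refine Finset.sum_eq_zero fun x _ => ?_
  rw [map_smul, Finsupp.lapply_apply, Finsupp.single_apply, if_neg, smul_zero]
  rintro rfl
  exact hS s hs (Finset.erase_subset _ _)

end FullChains

end TailAcyclic

namespace TailAcyclic

universe v

open Cardinal

/-! ### Extracting the coefficient of a vertex -/

section Contraction

variable {V : Type v} [LinearOrder V]

theorem sgn_singleton (x : V) : sgn x {x} = 1 := by
  simp [sgn, Finset.filter_singleton]

/-- Contraction with the vertex `x`: the coefficient of `x` in a chain. -/
noncomputable def contract (x : V) : (Finset V →₀ ℤ) →ₗ[ℤ] (Finset V →₀ ℤ) :=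
  Finsupp.linearCombination ℤ fun s =>
    if x ∈ s then sgn x s • Finsupp.single (s.erase x) (1 : ℤ) else 0

theorem contract_single_of_mem {x : V} {s : Finset V} (h : x ∈ s) :
    contract x (Finsupp.single s 1) = sgn x s • Finsupp.single (s.erase x) (1 : ℤ) := by
  simp [contract, h]

theorem contract_single_of_notMem {x : V} {s : Finset V} (h : x ∉ s) :
    contract x (Finsupp.single s 1) = 0 := by
  simp [contract, h]

theorem contract_cone_single {x : V} {s : Finset V} (h : x ∉ s) :
    contract x (cone x (Finsupp.single s 1)) = Finsupp.single s 1 := by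
  rw [cone_single_of_notMem h, map_smul, contract_single_of_mem (Finset.mem_insert_self x s),
    Finset.erase_insert h, sgn_insert_of_not_lt (lt_irrefl x), smul_smul, sgn_mul_self, one_smul]

theorem contract_apply {x : V} {t : Finset V} (h : x ∉ t) (z : Finset V →₀ ℤ) :
    contract x z t = sgn x t * z (insert x t) := by
  refine map_eq_of_single (S := Set.univ) (Finsupp.lapply t ∘ₗ contract x)
    (sgn x t • Finsupp.lapply (insert x t)) (fun s _ => ?_) (by simp [Finsupp.supported_univ])
  simp only [LinearMap.comp_apply, LinearMap.smul_apply, Finsupp.lapply_apply, smul_eq_mul]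
  by_cases hx : x ∈ s
  · rw [contract_single_of_mem hx, Finsupp.smul_apply, Finsupp.single_apply, Finsupp.single_apply]
    by_cases hs : s.erase x = t
    · subst hs
      rw [if_pos rfl, if_pos (Finset.insert_erase hx).symm, sgn_erase_self, smul_eq_mul]
    · rw [if_neg hs, if_neg]
      · simp
      · rintro rfl
        exact hs (Finset.erase_insert h)
  · rw [contract_single_of_notMem hx, Finsupp.single_apply, if_neg]
    · simp
    · rintro rfl
      exact hx (Finset.mem_insert_self x t)

theorem bd_single_mem_supported_erase {x : V} {s : Finset V} (h : x ∉ s) :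
    bd V (Finsupp.single s 1) ∈ Finsupp.supported ℤ ℤ {t | x ∉ t} := by
  rw [bd_single]
  exact Submodule.sum_mem _ fun y _ => Submodule.smul_mem _ _
    (single_mem fun hx => h (Finset.mem_of_mem_erase hx))

/-- Consequently the contraction of a cycle is a cycle, which lets independence be tested one
dimension lower. -/
theorem contract_bd (x : V) (z : Finset V →₀ ℤ) :
    contract x (bd V z) = -bd V (contract x z) := by
  refine map_eq_of_single (S := Set.univ) (contract x ∘ₗ bd V) (-(bd V ∘ₗ contract x))
    (fun s _ => ?_) (by simp [Finsupp.supported_univ])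
  simp only [LinearMap.comp_apply, LinearMap.neg_apply]
  have key : ∀ w ∈ Finsupp.supported ℤ ℤ {t : Finset V | x ∉ t}, contract x w = 0 := fun w hw =>
    map_eq_of_single (contract x) 0 (fun s hs => contract_single_of_notMem hs) hw
  by_cases hx : x ∈ s
  · rw [single_eq_cone hx]
    have ht : x ∉ s.erase x := Finset.notMem_erase _ _
    set t := s.erase x
    have h1 : contract x (cone x (bd V (Finsupp.single t 1))) = bd V (Finsupp.single t 1) :=
      map_eq_of_single (contract x ∘ₗ cone x) LinearMap.id (fun u hu => contract_cone_single hu)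
        (bd_single_mem_supported_erase ht)
    simp only [map_smul]
    rw [bd_cone, map_sub, h1, contract_single_of_notMem ht, contract_cone_single ht]
    simp
  · rw [contract_single_of_notMem hx, key _ (bd_single_mem_supported_erase hx)]
    simp

end Contraction

/-! ### Constructing tail bases from small cofinal subsets -/

section TailBases

variable {V : Type v} [LinearOrder V]

/-- The boundaries of the simplices in `B`, a set of `n`-simplices in `X`, are linearly
independent, and for every `a ∈ A` those with vertices in `[a, →)` generate the boundaries of all
`n`-simplices in `X ∩ [a, →)`. -/
structure IsTailBasis (n : ℕ) (X A : Set V) (B : Set (Finset V)) : Prop where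
  subset : B ⊆ simplices X (n + 1)
  inj : ∀ z ∈ Finsupp.supported ℤ ℤ B, bd V z = 0 → z = 0
  span : ∀ a ∈ A, ∀ s ∈ simplices (X ∩ Set.Ici a) (n + 1), bd V (Finsupp.single s 1) ∈
    (Finsupp.supported ℤ ℤ {t ∈ B | (t : Set V) ⊆ Set.Ici a}).map (bd V)

theorem IsTailBasis.anti {n : ℕ} {X A A' : Set V} {B : Set (Finset V)} (h : IsTailBasis n X A B)
    (hA : A' ⊆ A) : IsTailBasis n X A' B :=
  ⟨h.subset, h.inj, fun a ha => h.span a (hA ha)⟩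

/-- A cycle all of whose simplices contain `p` is killed by `cone p`, hence zero by the homotopy
formula. The same formula writes a boundary as the boundary of its cone, which stays in `[a, →)`
because `a ≤ p`. -/
theorem isTailBasis_cone (n : ℕ) {X A : Set V} {p : V} (hp : p ∈ X) (hA : ∀ a ∈ A, a ≤ p) :
    IsTailBasis n X A {s ∈ simplices X (n + 1) | p ∈ s} where
  subset := fun s hs => hs.1
  inj z hz h0 := by
    have h1 : cone p z = 0 :=
      map_eq_of_single (cone p) 0 (fun s hs => cone_single_of_mem hs.2) hz
    have h2 := bd_cone p z
    rw [h1, h0, map_zero, map_zero, sub_zero] at h2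
    exact h2.symm
  span a ha s hs := by
    refine ⟨cone p (bd V (Finsupp.single s 1)), ?_, by rw [bd_cone, bd_bd, map_zero, sub_zero]⟩
    refine map_mem_of_single _ (cone p) (fun t ht => ?_) (bd_mem (single_mem hs))
    by_cases hpt : p ∈ t
    · rw [cone_single_of_mem hpt]; exact Submodule.zero_mem _
    · rw [cone_single_of_notMem hpt]
      refine Submodule.smul_mem _ _ (single_mem ⟨⟨⟨?_, ?_⟩, Finset.mem_insert_self p t⟩, ?_⟩)
      · rw [Finset.card_insert_of_notMem hpt, ht.1]
      · rw [Finset.coe_insert]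
        exact Set.insert_subset hp (ht.2.trans Set.inter_subset_left)
      · rw [Finset.coe_insert]
        exact Set.insert_subset (hA a ha) (ht.2.trans Set.inter_subset_right)

/-- Tail bases in dimension `n` on the initial segments of a well-ordering of `X` yield a tail
basis in dimension `n + 1` on `X`. -/
theorem isTailBasis_glue {n : ℕ} {X : Set V} {W : Type*} [LinearOrder W] [WellFoundedLT W]
    {ρ : V → W} (hρ : Set.InjOn ρ X) {B : V → Set (Finset V)}
    (h : ∀ x ∈ X, IsTailBasis n {y ∈ X | ρ y < ρ x} (Set.Iic x) (B x)) :
    IsTailBasis (n + 1) X Set.univ {s | ∃ x ∈ X, ∃ t ∈ B x, s = insert x t} := by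
  have hnot : ∀ x ∈ X, ∀ t ∈ B x, x ∉ t := fun x hx t ht hxt =>
    lt_irrefl _ (((h x hx).subset ht).2 hxt).2
  refine ⟨?_, ?_, ?_⟩
  · rintro _ ⟨x, hx, t, ht, rfl⟩
    refine ⟨?_, ?_⟩
    · rw [Finset.card_insert_of_notMem (hnot x hx t ht), ((h x hx).subset ht).1]
    · rw [Finset.coe_insert]
      exact Set.insert_subset hx fun y hy => (((h x hx).subset ht).2 hy).1
  · intro z hz h0
    by_contra hne
    have hsupp : ∀ s ∈ z.support, ∃ x ∈ X, ∃ t ∈ B x, s = insert x t := fun s hs => hz hs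
    obtain ⟨s₁, hs₁⟩ := Finsupp.support_nonempty_iff.2 hne
    have : Nonempty V := ⟨(hsupp s₁ hs₁).choose⟩
    choose! top htop t ht hst using hsupp
    -- In `insert x t` with `t ∈ B x`, the vertex `x` is the `ρ`-largest. With `x` maximal among
    -- these top vertices, every simplex of `z` containing `x` has top `x`, so contracting gives a
    -- cycle on `B x`. It must vanish, although `s₀` contributes a nonzero coefficient.
    obtain ⟨s₀, hs₀, hmax⟩ := Finset.exists_max_image z.support (fun s => ρ (top s))
      (Finsupp.support_nonempty_iff.2 hne)
    set x := top s₀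
    have hxX : x ∈ X := htop s₀ hs₀
    have hv : contract x z ∈ Finsupp.supported ℤ ℤ (B x) := by
      refine map_mem_of_single _ (contract x) (S := (z.support : Set (Finset V)))
        (fun s hs => ?_) (by simp [Finsupp.mem_supported])
      by_cases hxs : x ∈ s
      · have hs' := hst s hs
        have : x = top s := by
          by_contra hxt
          have hmem : x ∈ t s := by
            rw [hs'] at hxs
            exact (Finset.mem_insert.1 hxs).resolve_left hxt
          exact ((((h _ (htop s hs)).subset (ht s hs)).2 hmem).2.trans_le (hmax s hs)).false
        have hB : s.erase x ∈ B x := by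
          rw [hs', this, Finset.erase_insert (hnot _ (htop s hs) _ (ht s hs))]
          exact ht s hs
        rw [contract_single_of_mem hxs]
        exact Submodule.smul_mem _ _ (single_mem hB)
      · rw [contract_single_of_notMem hxs]; exact Submodule.zero_mem _
    have hv0 : contract x z = 0 := by
      refine (h x hxX).inj _ hv ?_
      have := contract_bd x z
      rw [h0, map_zero] at this
      exact neg_eq_zero.1 this.symm
    have hc := contract_apply (hnot x hxX _ (ht s₀ hs₀)) z
    rw [hv0, ← hst s₀ hs₀] at hc
    exact (mul_ne_zero (sgn_ne_zero _ _) (Finsupp.mem_support_iff.1 hs₀)) hc.symm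
  · intro a _
    set N := (Finsupp.supported ℤ ℤ
      {t ∈ {s | ∃ x ∈ X, ∃ t ∈ B x, s = insert x t} | (t : Set V) ⊆ Set.Ici a}).map (bd V)
    -- Induction on the `ρ`-largest vertex `x` of `s`. The face `t` opposite `x` has the same
    -- boundary as a chain `v` on `B x`. The cycle `t - v` bounds a chain `w` of simplices lying
    -- `ρ`-below `x`, so the boundary of the cone over `t` is that of the cone over `v` plus that of
    -- `w`. Since `a ≤ x`, spanning by `B x` is needed only for tails starting in `Set.Iic x`.
    have key : ∀ o : W, ∀ x ∈ X, ρ x = o → ∀ s ∈ simplices (X ∩ Set.Ici a) (n + 2), x ∈ s →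
        (∀ y ∈ s, ρ y ≤ ρ x) → bd V (Finsupp.single s 1) ∈ N := by
      intro o
      induction o using WellFoundedLT.induction with
      | ind o ih =>
      rintro x hx rfl s hs hxs hmax
      have hax : a ≤ x := (hs.2 hxs).2
      have ht : s.erase x ∈ simplices ({y ∈ X | ρ y < ρ x} ∩ Set.Ici a) (n + 1) := by
        refine ⟨by rw [Finset.card_erase_of_mem hxs, hs.1]; rfl, fun y hy => ?_⟩
        obtain ⟨hyx, hys⟩ := Finset.mem_erase.1 (Finset.mem_coe.1 hy)
        exact ⟨⟨(hs.2 hys).1, lt_of_le_of_ne (hmax y hys)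
          fun he => hyx (hρ (hs.2 hys).1 hx he)⟩, (hs.2 hys).2⟩
      obtain ⟨v, hv, hvt⟩ := (h x hx).span a hax _ ht
      set t := s.erase x
      have hr : Finsupp.single t 1 - v ∈
          Finsupp.supported ℤ ℤ (simplices ({y ∈ X | ρ y < ρ x} ∩ Set.Ici a) (n + 1)) := by
        refine Submodule.sub_mem _ (single_mem ht) (Finsupp.supported_mono ?_ hv)
        exact fun u hu => ⟨((h x hx).subset hu.1).1,
          Set.subset_inter ((h x hx).subset hu.1).2 hu.2⟩
      have hr0 : bd V (Finsupp.single t 1 - v) = 0 := by rw [map_sub, hvt, sub_self]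
      obtain ⟨w, hw, hwr⟩ := exists_bd_eq hr hr0
      have hwN : bd V w ∈ N := by
        refine map_mem_of_single _ (bd V) (fun u hu => ?_) hw
        have hune : u.Nonempty := Finset.card_pos.1 (by rw [hu.1]; omega)
        obtain ⟨y, hy, hymax⟩ := Finset.exists_max_image u ρ hune
        exact ih (ρ y) (hu.2 hy).1.2 y (hu.2 hy).1.1 rfl u
          ⟨hu.1, fun y' hy' => ⟨(hu.2 hy').1.1, (hu.2 hy').2⟩⟩ hy hymax
      have hcone : bd V (cone x (Finsupp.single t 1)) = bd V (cone x v) + bd V w := by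
        rw [hwr, ← sub_eq_iff_eq_add', ← map_sub, ← map_sub, bd_cone, hr0, map_zero, sub_zero]
      rw [single_eq_cone hxs, map_smul, map_smul, hcone]
      refine Submodule.smul_mem _ _ (Submodule.add_mem _ (Submodule.mem_map_of_mem ?_) hwN)
      refine map_mem_of_single _ (cone x) (fun u hu => ?_) hv
      rw [cone_single_of_notMem (hnot x hx u hu.1)]
      refine Submodule.smul_mem _ _ (single_mem ⟨⟨x, hx, u, hu.1, rfl⟩, ?_⟩)
      rw [Finset.coe_insert]
      exact Set.insert_subset hax hu.2
    intro s hs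
    have hsne : s.Nonempty := Finset.card_pos.1 (by rw [hs.1]; omega)
    obtain ⟨y, hy, hymax⟩ := Finset.exists_max_image s ρ hsne
    exact key (ρ y) y (hs.2 hy).1 rfl s hs hy hymax

/-- All vertices have the same boundary, the empty simplex, and the greatest vertex lies in every
nonempty tail. -/
theorem isTailBasis_zero {X : Set V} {m : V} (hm : m ∈ X) (hX : ∀ x ∈ X, x ≤ m) :
    IsTailBasis 0 X Set.univ {{m}} where
  subset := by
    rintro _ rfl
    exact ⟨rfl, by simpa using hm⟩
  inj z hz h0 := by
    have h1 : bd V z ∅ = z {m} := by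
      refine map_eq_of_single (Finsupp.lapply ∅ ∘ₗ bd V) (Finsupp.lapply {m}) (fun s hs => ?_) hz
      rw [Set.mem_singleton_iff.1 hs, LinearMap.comp_apply, bd_single]
      simp [sgn_singleton]
    rw [h0] at h1
    ext s
    by_cases hs : s = {m}
    · rw [hs, ← h1]; rfl
    · exact Finsupp.notMem_support_iff.1 fun hs' => hs (hz hs')
  span a _ s hs := by
    obtain ⟨x, rfl⟩ := Finset.card_eq_one.1 hs.1
    have hx : x ∈ X ∩ Set.Ici a := hs.2 (by simp)
    refine ⟨Finsupp.single {m} 1, single_mem ⟨rfl, ?_⟩, ?_⟩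
    · simpa using le_trans (Set.mem_Ici.1 hx.2) (hX x hx.1)
    · rw [bd_single, bd_single]
      simp [sgn_singleton]

theorem isTailBasis_empty (n : ℕ) : IsTailBasis n (∅ : Set V) Set.univ ∅ where
  subset := Set.empty_subset _
  inj z hz _ := by simpa using hz
  span a _ s hs := by
    have : s = ∅ := by
      have := hs.2
      rwa [Set.empty_inter, Set.subset_empty_iff, Finset.coe_eq_empty] at this
    subst this
    exact absurd hs.1 (by simp)

/-- A set with a cofinal subset of size less than `ℵ_n` has a tail basis in dimension `n`. -/
theorem exists_isTailBasis (n : ℕ) (X C : Set V) (hCX : C ⊆ X) (hC : ∀ x ∈ X, ∃ c ∈ C, x ≤ c)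
    (hcard : #C < ℵ_ n) : ∃ B, IsTailBasis n X Set.univ B := by
  induction n generalizing X C with
  | zero =>
    rcases X.eq_empty_or_nonempty with rfl | ⟨x₀, hx₀⟩
    · exact ⟨∅, isTailBasis_empty 0⟩
    have hfin : C.Finite := by
      rw [← Cardinal.lt_aleph0_iff_set_finite]
      simpa using hcard
    obtain ⟨c₀, hc₀, -⟩ := hC x₀ hx₀
    obtain ⟨m, hm, hmax⟩ := Set.exists_max_image C id hfin ⟨c₀, hc₀⟩
    refine ⟨{{m}}, isTailBasis_zero (hCX hm) fun x hx => ?_⟩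
    obtain ⟨c, hc, hxc⟩ := hC x hx
    exact hxc.trans (hmax c hc)
  | succ n ih =>
    classical
    -- `ρ` lists `C` first, in the order type of its cardinal, and then the rest of `X`.
    obtain ⟨r, wo, hr⟩ := Cardinal.exists_ord_eq C
    let ρ : V → Ordinal := fun x =>
      if hx : x ∈ C then Ordinal.typein r ⟨x, hx⟩
      else (#C).ord + Ordinal.typein WellOrderingRel x
    have hρC : ∀ x (hx : x ∈ C), ρ x = Ordinal.typein r ⟨x, hx⟩ := fun x hx => dif_pos hx
    have hρC' : ∀ x, x ∉ C → ρ x = (#C).ord + Ordinal.typein WellOrderingRel x :=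
      fun x hx => dif_neg hx
    have hlt : ∀ x ∈ C, ρ x < (#C).ord := fun x hx => by
      rw [hρC x hx, hr]; exact Ordinal.typein_lt_type r _
    have hle : ∀ x, x ∉ C → (#C).ord ≤ ρ x := fun x hx => by
      rw [hρC' x hx]; exact le_self_add
    have hinj : Set.InjOn ρ X := by
      intro x _ y _ hxy
      by_cases hx : x ∈ C <;> by_cases hy : y ∈ C
      · rw [hρC x hx, hρC y hy] at hxy
        exact congrArg Subtype.val (Ordinal.typein_injective r hxy)
      · exact absurd hxy ((hlt x hx).trans_le (hle y hy)).ne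
      · exact absurd hxy ((hlt y hy).trans_le (hle x hx)).ne'
      · rw [hρC' x hx, hρC' y hy] at hxy
        exact Ordinal.typein_injective WellOrderingRel (add_left_cancel hxy)
    have hB : ∀ x ∈ X, ∃ B, IsTailBasis n {y ∈ X | ρ y < ρ x} (Set.Iic x) B := by
      intro x hx
      by_cases hxC : x ∈ C
      -- Since `#C ≤ ℵ_ n`, an element of `C` has fewer than `ℵ_ n` predecessors, and these form a
      -- cofinal subset of themselves.
      · have hI : #{y ∈ X | ρ y < ρ x} < ℵ_ n := by
          have h1 : #{y ∈ X | ρ y < ρ x} ≤ #{y : C // r y ⟨x, hxC⟩} := by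
            refine Cardinal.mk_le_of_injective (f := fun y => ⟨⟨y.1, ?_⟩, ?_⟩) ?_
            · by_contra hy
              exact ((hlt x hxC).trans_le (hle y hy)).not_gt y.2.2
            · have hy : y.1 ∈ C := by
                by_contra hy
                exact ((hlt x hxC).trans_le (hle y hy)).not_gt y.2.2
              rw [← Ordinal.typein_lt_typein r, ← hρC _ hy, ← hρC _ hxC]
              exact y.2.2
            · intro y y' hyy
              simpa [Subtype.ext_iff] using hyy
          have h2 := Cardinal.card_typein_lt (r := r) ⟨x, hxC⟩ hr
          have h3 : #C ≤ ℵ_ n := by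
            rw [Nat.cast_succ, ← Cardinal.succ_aleph] at hcard
            exact Order.lt_succ_iff.1 hcard
          exact (h1.trans_lt h2).trans_le h3
        obtain ⟨B, hB⟩ := ih _ _ subset_rfl (fun y hy => ⟨y, hy, le_rfl⟩) hI
        exact ⟨B, hB.anti (Set.subset_univ _)⟩
      -- A point outside `C` comes after all of `C`, so some `p ∈ C` above it in `V` is available
      -- among its predecessors as a cone apex.
      · obtain ⟨p, hp, hxp⟩ := hC x hx
        exact ⟨_, isTailBasis_cone n (p := p)
          ⟨hCX hp, (hlt p hp).trans_le (hle x hxC)⟩ fun a ha => le_trans ha hxp⟩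
    choose! B hB using hB
    exact ⟨_, isTailBasis_glue hinj hB⟩

end TailBases

end TailAcyclic

namespace TailAcyclic

universe v

open Cardinal

/-! ### Tail-preserving splittings and their descent in dimension -/

section Splittings

variable {V : Type v}

open scoped Classical in
/-- The projection onto the chains with vertices in `Z`. -/
noncomputable def proj (Z : Set V) : (Finset V →₀ ℤ) →ₗ[ℤ] (Finset V →₀ ℤ) :=
  Finsupp.linearCombination ℤ fun s => if (s : Set V) ⊆ Z then Finsupp.single s (1 : ℤ) else 0

theorem proj_mem {Z X A : Set V} {m : ℕ} {z : Finset V →₀ ℤ}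
    (hz : z ∈ Finsupp.supported ℤ ℤ (simplices (X ∩ A) m)) :
    proj Z z ∈ Finsupp.supported ℤ ℤ (simplices (Z ∩ A) m) := by
  refine map_mem_of_single _ (proj Z) (fun s hs => ?_) hz
  by_cases h : (s : Set V) ⊆ Z
  · simp only [proj, Finsupp.linearCombination_single, h, if_true, one_smul]
    exact single_mem ⟨hs.1, Set.subset_inter h (hs.2.trans Set.inter_subset_right)⟩
  · simp [proj, h]

theorem proj_eq_self {Z : Set V} {m : ℕ} {z : Finset V →₀ ℤ}
    (hz : z ∈ Finsupp.supported ℤ ℤ (simplices Z m)) : proj Z z = z :=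
  map_eq_of_single (proj Z) LinearMap.id (fun s hs => by simp [proj, hs.2]) hz

variable [LinearOrder V]

/-- `φ` preserves the `n`-chains on each tail of `X`, commutes with the boundary map, and kills
boundaries; thus it encodes a section of `d_n : P_n(X) → d_n P_n(X)`. -/
structure IsTailSplitting (n : ℕ) (X : Set V) (φ : (Finset V →₀ ℤ) →ₗ[ℤ] (Finset V →₀ ℤ)) :
    Prop where
  tail : ∀ a, ∀ s ∈ simplices (X ∩ Set.Ici a) (n + 1),
    φ (Finsupp.single s 1) ∈ Finsupp.supported ℤ ℤ (simplices (X ∩ Set.Ici a) (n + 1))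
  bd_eq : ∀ z ∈ Finsupp.supported ℤ ℤ (simplices X (n + 1)), bd V (φ z) = bd V z
  ker : ∀ z ∈ Finsupp.supported ℤ ℤ (simplices X (n + 2)), φ (bd V z) = 0

theorem IsTailSplitting.mem {n : ℕ} {X : Set V} {φ : (Finset V →₀ ℤ) →ₗ[ℤ] (Finset V →₀ ℤ)}
    (h : IsTailSplitting n X φ) {s : Finset V} (hs : s ∈ simplices X (n + 1)) :
    φ (Finsupp.single s 1) ∈ Finsupp.supported ℤ ℤ (simplices X (n + 1)) := by
  have hne : s.Nonempty := Finset.card_pos.1 (by rw [hs.1]; omega)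
  exact Finsupp.supported_mono (simplices_mono Set.inter_subset_left _)
    (h.tail (s.min' hne) s ⟨hs.1, Set.subset_inter hs.2 fun y hy => s.min'_le y hy⟩)

/-- A splitting in dimension `n + 1` restricts to a splitting in dimension `n` on every invariant
subset that is bounded from above. -/
theorem IsTailSplitting.descend {n : ℕ} {X Z : Set V}
    {φ : (Finset V →₀ ℤ) →ₗ[ℤ] (Finset V →₀ ℤ)} (h : IsTailSplitting (n + 1) X φ) (hZX : Z ⊆ X)
    (hZ : ∀ s ∈ simplices Z (n + 2),
      φ (Finsupp.single s 1) ∈ Finsupp.supported ℤ ℤ (simplices Z (n + 2)))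
    {x : V} (hxX : x ∈ X) (hx : ∀ z ∈ Z, z < x) :
    IsTailSplitting n Z (LinearMap.id - bd V ∘ₗ proj Z ∘ₗ φ ∘ₗ cone x) where
  -- The cone stays in the tail because `x` lies above `Z`. As `x ∉ Z`, applying `φ` to the cone may
  -- leave `Z`, whence the projection.
  tail a s hs := by
    have hne : s.Nonempty := Finset.card_pos.1 (by rw [hs.1]; omega)
    obtain ⟨y, hy⟩ := hne
    have hax : a ≤ x := le_trans (hs.2 hy).2 (hx y (hs.2 hy).1).le
    have h1 := cone_mem (X := X ∩ Set.Ici a) ⟨hxX, hax⟩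
      (single_mem (simplices_mono (Set.inter_subset_inter_left _ hZX) _ hs))
    have h2 := map_mem_of_single _ φ (h.tail a) h1
    exact Submodule.sub_mem _ (single_mem hs) (bd_mem (proj_mem h2))
  bd_eq z _ := by simp [bd_bd]
  ker z hz := by
    have hz' := Finsupp.supported_mono (simplices_mono hZX _) hz
    -- The two chains differ by a boundary, which `φ` kills. As `φ z` already lies over `Z`, the
    -- correction term at `bd V z` is then exactly `bd V z`.
    have h1 : φ (cone x (bd V z)) = φ z := by
      have := bd_cone x z
      rw [eq_sub_iff_add_eq, ← eq_sub_iff_add_eq'] at this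
      rw [this, map_sub, h.ker _ (cone_mem hxX hz'), sub_zero]
    have h2 : proj Z (φ z) = φ z := proj_eq_self (map_mem_of_single _ φ hZ hz)
    simp [h1, h2, h.bd_eq z hz']

theorem bd_singleton (x : V) :
    bd V (Finsupp.single {x} 1) = Finsupp.single (∅ : Finset V) 1 := by
  rw [bd_single]
  simp [sgn_singleton]

/-- Two vertices differ by a boundary, so `φ` sends all of them to one chain, nonzero since its
augmentation is `1`. Preservation of tails places every vertex of its support above every point of
`X`. -/
theorem IsTailSplitting.exists_max {X : Set V} {φ : (Finset V →₀ ℤ) →ₗ[ℤ] (Finset V →₀ ℤ)}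
    (h : IsTailSplitting 0 X φ) (hX : X.Nonempty) : ∃ m ∈ X, ∀ x ∈ X, x ≤ m := by
  obtain ⟨a, ha⟩ := hX
  have hsing : ∀ x ∈ X, ∀ b ≤ x, {x} ∈ simplices (X ∩ Set.Ici b) 1 := fun x hx b hb =>
    ⟨rfl, by simpa using ⟨hx, hb⟩⟩
  have hsing' : ∀ x ∈ X, {x} ∈ simplices X 1 := fun x hx => ⟨rfl, by simpa using hx⟩
  have hconst : ∀ x ∈ X, φ (Finsupp.single {x} 1) = φ (Finsupp.single {a} 1) := by
    intro x hx
    have h1 := bd_cone a (Finsupp.single {x} 1)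
    have h2 : cone a (bd V (Finsupp.single {x} 1)) = Finsupp.single {a} 1 := by
      rw [bd_singleton, cone_single_of_notMem (Finset.notMem_empty a)]
      simp [sgn]
    rw [h2] at h1
    have h3 := h.ker _ (cone_mem ha (single_mem (hsing' x hx)))
    rw [h1, map_sub, sub_eq_zero] at h3
    exact h3
  have hne : φ (Finsupp.single {a} 1) ≠ 0 := by
    intro h0
    have h1 := h.bd_eq _ (single_mem (hsing' a ha))
    rw [h0, map_zero, bd_singleton] at h1
    exact Finsupp.single_ne_zero.2 one_ne_zero h1.symm
  obtain ⟨s, hs⟩ := Finsupp.support_nonempty_iff.2 hne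
  have hs1 := h.mem (hsing' a ha) hs
  obtain ⟨m, rfl⟩ := Finset.card_eq_one.1 hs1.1
  refine ⟨m, hs1.2 (by simp), fun x hx => ?_⟩
  have := h.tail x {x} (hsing x hx x le_rfl)
  rw [hconst x hx] at this
  exact ((this hs).2 (by simp : m ∈ (({m} : Finset V) : Set V))).2

end Splittings

/-! ### Closing-off argument and the cofinality bound -/

section Closure

variable {V : Type v}

theorem mk_finset_le {S : Type v} {κ : Cardinal.{v}} (hκ : ℵ₀ ≤ κ) (h : #S ≤ κ) :
    #(Finset S) ≤ κ := by
  rcases finite_or_infinite S with hS | hS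
  · exact (Cardinal.lt_aleph0_of_finite _).le.trans hκ
  · rwa [Cardinal.mk_finset_of_infinite]

theorem mk_iUnion_le_of_le {ι : Type v} {κ : Cardinal.{v}} (hκ : ℵ₀ ≤ κ) {F : ι → Set V}
    (hι : #ι ≤ κ) (hF : ∀ i, #(F i) ≤ κ) : #(⋃ i, F i) ≤ κ := by
  refine (Cardinal.mk_iUnion_le F).trans ((mul_le_mul' hι (ciSup_le' hF)).trans ?_)
  rw [Cardinal.mul_eq_self hκ]

/-- The union of the increasing chain along `ι` that is produced by iterating `T`. -/
noncomputable def iterChain {ι : Type v} [LinearOrder ι] [WellFoundedLT ι] (T : Set V → Set V) :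
    ι → Set V :=
  wellFounded_lt.fix fun i F => T (⋃ j : Set.Iio i, F j.1 j.2)

theorem iterChain_eq {ι : Type v} [LinearOrder ι] [WellFoundedLT ι] (T : Set V → Set V) (i : ι) :
    iterChain T i = T (⋃ j : Set.Iio i, iterChain T j.1) :=
  wellFounded_lt.fix_eq _ i

variable [LinearOrder V]

/-- If all subsets of `X` of size at most the regular cardinal `κ` are bounded in `X`, then `X`
has a subset `Z` of size at most `κ` that is closed under a given finitary operation and in which
all sets of size less than `κ` are bounded. -/
theorem exists_closed_subset {κ : Cardinal.{v}} (hκ : κ.IsRegular) {X : Set V}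
    (hX : ∀ C ⊆ X, #C ≤ κ → ∃ x ∈ X, ∀ c ∈ C, c < x) (f : Finset V → Finset V)
    (hf : ∀ s : Finset V, (s : Set V) ⊆ X → (f s : Set V) ⊆ X) :
    ∃ Z ⊆ X, #Z ≤ κ ∧ (∀ s : Finset V, (s : Set V) ⊆ Z → (f s : Set V) ⊆ Z) ∧
      ∀ W ⊆ Z, #W < κ → ∃ z ∈ Z, ∀ w ∈ W, w < z := by
  classical
  obtain ⟨x₀, -⟩ := hX ∅ (Set.empty_subset _) (by simp)
  have : Nonempty V := ⟨x₀⟩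
  choose! β hβX hβ using hX
  -- Each stage adds a strict bound of the previous stages and the values of `f` on their finite
  -- subsets.
  let T : Set V → Set V := fun S =>
    insert (β S) (⋃ s : Finset S, (f (s.map (Function.Embedding.subtype _)) : Set V))
  let ι := κ.ord.ToType
  have hι : #ι = κ := Cardinal.mk_ord_toType κ
  let F : ι → Set V := iterChain T
  have hF : ∀ i, F i = T (⋃ j : Set.Iio i, F j.1) := iterChain_eq T
  have hFX : ∀ i, F i ⊆ X ∧ #(F i) ≤ κ := by
    intro i
    induction i using WellFoundedLT.induction with
    | ind i ih =>
    have h1 : (⋃ j : Set.Iio i, F j.1) ⊆ X := Set.iUnion_subset fun j => (ih j.1 j.2).1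
    have h2 : #(⋃ j : Set.Iio i, F j.1) ≤ κ :=
      mk_iUnion_le_of_le hκ.aleph0_le ((Cardinal.mk_set_le _).trans hι.le) fun j => (ih j.1 j.2).2
    rw [hF]
    refine ⟨Set.insert_subset (hβX _ h1 h2) (Set.iUnion_subset fun s => hf _ ?_), ?_⟩
    · intro y hy
      obtain ⟨y', -, rfl⟩ := Finset.mem_map.1 (Finset.mem_coe.1 hy)
      exact h1 y'.2
    · refine Cardinal.mk_insert_le.trans (Cardinal.add_le_of_le hκ.aleph0_le ?_
        (Cardinal.one_le_aleph0.trans hκ.aleph0_le))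
      exact mk_iUnion_le_of_le hκ.aleph0_le (mk_finset_le hκ.aleph0_le h2) fun s =>
        (Cardinal.lt_aleph0_of_finite _).le.trans hκ.aleph0_le
  have hbdd : ∀ W ⊆ ⋃ i, F i, #W < κ → ∃ i, W ⊆ ⋃ j : Set.Iio i, F j.1 := by
    intro W hW hcard
    have h1 : ∀ w : W, ∃ i, w.1 ∈ F i := fun w => Set.mem_iUnion.1 (hW w.2)
    choose g hg using h1
    -- By regularity, fewer than `κ` stages cannot be cofinal, so small subsets of the union appear
    -- before some stage `i`, which contains a bound for them.
    have h2 : ¬ IsCofinal (Set.range g) := by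
      intro h
      have h3 := (Order.cof_le h).trans Cardinal.mk_range_le
      rw [Ordinal.cof_toType, hκ.cof_ord] at h3
      exact (h3.trans_lt hcard).false
    simp only [IsCofinal, not_forall, not_exists, not_and, not_le] at h2
    obtain ⟨i, hi⟩ := h2
    exact ⟨i, fun w hw => Set.mem_iUnion.2 ⟨⟨g ⟨w, hw⟩, hi _ ⟨_, rfl⟩⟩, hg ⟨w, hw⟩⟩⟩
  refine ⟨⋃ i, F i, Set.iUnion_subset fun i => (hFX i).1,
    mk_iUnion_le_of_le hκ.aleph0_le hι.le fun i => (hFX i).2, fun s hs => ?_, fun W hW hcard => ?_⟩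
  · obtain ⟨i, hi⟩ := hbdd s hs ((Cardinal.lt_aleph0_of_finite _).trans_le hκ.aleph0_le)
    refine Set.Subset.trans ?_ (Set.subset_iUnion F i)
    rw [hF]
    refine Set.Subset.trans ?_ (Set.subset_insert _ _)
    refine Set.Subset.trans ?_ (Set.subset_iUnion _ (s.subtype (· ∈ ⋃ j : Set.Iio i, F j.1)))
    rw [Finset.subtype_map_of_mem hi]
  · obtain ⟨i, hi⟩ := hbdd W hW hcard
    have h1 : (⋃ j : Set.Iio i, F j.1) ⊆ X := Set.iUnion_subset fun j => (hFX j.1).1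
    have h2 : #(⋃ j : Set.Iio i, F j.1) ≤ κ :=
      mk_iUnion_le_of_le hκ.aleph0_le ((Cardinal.mk_set_le _).trans hι.le) fun j => (hFX j.1).2
    refine ⟨β (⋃ j : Set.Iio i, F j.1), Set.mem_iUnion.2 ⟨i, ?_⟩, fun w hw => hβ _ h1 h2 w (hi hw)⟩
    rw [hF]
    exact Set.mem_insert _ _

theorem isRegular_aleph_nat (n : ℕ) : (ℵ_ (n : Ordinal.{v})).IsRegular := by
  cases n with
  | zero => simpa using Cardinal.isRegular_aleph0
  | succ n => rw [Nat.cast_succ]; exact Cardinal.isRegular_aleph_add_one _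

/-- A set with a splitting in dimension `n` has a cofinal subset of size less than `ℵ_n`. -/
theorem IsTailSplitting.exists_cofinal (n : ℕ) {X : Set V}
    {φ : (Finset V →₀ ℤ) →ₗ[ℤ] (Finset V →₀ ℤ)} (h : IsTailSplitting n X φ) :
    ∃ C ⊆ X, (∀ x ∈ X, ∃ c ∈ C, x ≤ c) ∧ #C < ℵ_ n := by
  induction n generalizing X φ with
  | zero =>
    rcases X.eq_empty_or_nonempty with rfl | hX
    · exact ⟨∅, subset_rfl, by simp, by simp [Cardinal.aleph0_pos]⟩
    · obtain ⟨m, hm, hmax⟩ := h.exists_max hX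
      exact ⟨{m}, by simpa using hm, fun x hx => ⟨m, rfl, hmax x hx⟩, by simp⟩
  | succ n ih =>
    by_contra! hcof
    have hsucc : ∀ C : Set V, #C ≤ ℵ_ n ↔ #C < ℵ_ ((n + 1 : ℕ) : Ordinal.{v}) := fun C => by
      rw [Nat.cast_succ, ← Cardinal.succ_aleph, Order.lt_succ_iff]
    have hX : ∀ C ⊆ X, #C ≤ ℵ_ n → ∃ x ∈ X, ∀ c ∈ C, c < x := by
      intro C hC hcard
      by_contra! hx
      exact ((hcof C hC hx).trans_lt ((hsucc C).1 hcard)).false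
    -- Closure under `f` makes the chains on `Z` invariant under `φ`. The resulting `Z` has no
    -- cofinal subset of size less than `ℵ_ n`, yet is bounded in `X`, so `IsTailSplitting.descend`
    -- applies.
    let f : Finset V → Finset V := fun s =>
      if s.card = n + 2 then (φ (Finsupp.single s 1)).support.biUnion id else ∅
    obtain ⟨Z, hZX, hZcard, hZf, hZ⟩ := exists_closed_subset (isRegular_aleph_nat n) hX f (by
      intro s hs
      by_cases hcard : s.card = n + 2
      · simp only [f, hcard, if_true]
        intro y hy
        obtain ⟨t, ht, hyt⟩ := Finset.mem_biUnion.1 (Finset.mem_coe.1 hy)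
        exact (h.mem ⟨hcard, hs⟩ ht).2 hyt
      · simp [f, hcard])
    obtain ⟨x, hxX, hx⟩ := hX Z hZX hZcard
    have hinv : ∀ s ∈ simplices Z (n + 2),
        φ (Finsupp.single s 1) ∈ Finsupp.supported ℤ ℤ (simplices Z (n + 2)) := by
      intro s hs t ht
      refine ⟨(h.mem ⟨hs.1, hs.2.trans hZX⟩ ht).1, fun y hy => hZf s hs.2 ?_⟩
      simp only [f, hs.1, if_true]
      exact Finset.mem_coe.2 (Finset.mem_biUnion.2 ⟨t, ht, hy⟩)
    obtain ⟨W, hWZ, hW, hWcard⟩ := ih (h.descend hZX hinv hxX hx)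
    obtain ⟨z, hz, hlt⟩ := hZ W hWZ hWcard
    obtain ⟨w, hw, hzw⟩ := hW z hz
    exact (hlt w hw).not_ge hzw

end Closure

end TailAcyclic

namespace TailAcyclic

universe v

/-! ### Chains of a complex inside the group of all chains -/

section Faces

variable {V : Type v}

/-- The faces of `K` with `m` vertices, as a set of finite sets. -/
def faceSet (K : PreAbstractSimplicialComplex V) (m : ℕ) : Set (Finset V) :=
  {s | s.card = m ∧ (s = ∅ ∨ s ∈ K.faces)}

/-- The inclusion of the chains of a complex into the group of all chains. -/
noncomputable def toFull (K : PreAbstractSimplicialComplex V) (m : ℕ) :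
    Chains K m →ₗ[ℤ] (Finset V →₀ ℤ) :=
  Finsupp.lmapDomain ℤ ℤ fun s : Face K m => s.1

theorem toFull_single {K : PreAbstractSimplicialComplex V} {m : ℕ} (s : Face K m) (a : ℤ) :
    toFull K m (Finsupp.single s a) = Finsupp.single s.1 a := by
  simp [toFull, Finsupp.mapDomain_single]

theorem toFull_injective (K : PreAbstractSimplicialComplex V) (m : ℕ) :
    Function.Injective (toFull K m) :=
  Finsupp.mapDomain_injective fun _ _ h => Subtype.ext h

theorem range_toFull (K : PreAbstractSimplicialComplex V) (m : ℕ) :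
    LinearMap.range (toFull K m) = Finsupp.supported ℤ ℤ (faceSet K m) := by
  refine le_antisymm ?_ fun z hz => ?_
  · rintro _ ⟨c, rfl⟩
    refine map_mem_of_single (S := Set.univ) _ (toFull K m) (fun s _ => ?_)
      (by simp [Finsupp.supported_univ])
    rw [toFull_single]
    exact single_mem s.2
  · exact map_mem_of_single (LinearMap.range (toFull K m)) LinearMap.id
      (fun s hs => ⟨Finsupp.single (⟨s, hs⟩ : Face K m) 1, toFull_single _ _⟩) hz

theorem toFull_chainsIncl {K L : PreAbstractSimplicialComplex V} (h : K ≤ L) (m : ℕ)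
    (c : Chains K m) : toFull L m (chainsIncl h m c) = toFull K m c :=
  Finsupp.mapDomain_comp.symm

theorem toFull_boundary [LinearOrder V] (K : PreAbstractSimplicialComplex V) (m : ℕ)
    (c : Chains K (m + 1)) : toFull K m (boundary K m c) = bd V (toFull K (m + 1) c) := by
  refine map_eq_of_single (S := Set.univ) (toFull K m ∘ₗ boundary K m)
    (bd V ∘ₗ toFull K (m + 1)) (fun s _ => ?_) (by simp [Finsupp.supported_univ])
  rw [LinearMap.comp_apply, LinearMap.comp_apply, toFull_single, bd_single, boundary,
    Finsupp.linearCombination_single, one_smul, map_sum, ← Finset.sum_attach s.1]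
  refine Finset.sum_congr rfl fun x _ => ?_
  rw [map_smul, toFull_single]
  rfl

theorem subsingleton_reducedHomology_iff [LinearOrder V] (K : PreAbstractSimplicialComplex V)
    (k : ℕ) : Subsingleton (ReducedHomology K k) ↔
      ∀ z ∈ Finsupp.supported ℤ ℤ (faceSet K (k + 1)), bd V z = 0 →
        ∃ w ∈ Finsupp.supported ℤ ℤ (faceSet K (k + 2)), bd V w = z := by
  rw [Submodule.Quotient.subsingleton_iff, Submodule.submoduleOf,
    Submodule.comap_subtype_eq_top]
  simp only [← range_toFull]
  constructor
  · rintro h _ ⟨c, rfl⟩ h0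
    rw [← toFull_boundary] at h0
    obtain ⟨w, hw⟩ := h (LinearMap.mem_ker.2 (toFull_injective K k (h0.trans (map_zero _).symm)))
    exact ⟨_, ⟨w, rfl⟩, by rw [← toFull_boundary, hw]⟩
  · intro h c hc
    obtain ⟨_, ⟨w, rfl⟩, hw⟩ := h _ ⟨c, rfl⟩ (by
      rw [← toFull_boundary, LinearMap.mem_ker.1 hc, map_zero])
    rw [← toFull_boundary] at hw
    exact ⟨w, toFull_injective _ _ hw⟩

theorem faceSet_tail [LinearOrder V] (a : V) (m : ℕ) :
    faceSet (tail a) m = simplices (Set.Ici a) m := by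
  ext s
  refine and_congr_right fun _ => ⟨?_, fun h => ?_⟩
  · rintro (rfl | h)
    · simp
    · exact h.2
  · exact s.eq_empty_or_nonempty.imp id fun hs => ⟨hs, h⟩

end Faces

/-! ### Bases of `d_n P_n` as independent, tailwise spanning families -/

section Bases

variable {V : Type v} [LinearOrder V]

/-- The terms of the system `d_n P_n`, as subgroups of the group of all chains. -/
noncomputable def dPVal (n : ℕ) (a : V) : (dP V n).obj (op a) →+ (Finset V →₀ ℤ) :=
  (toFull (tail a) n).toAddMonoidHom.comp (AddSubgroup.subtype _)

theorem dPVal_injective (n : ℕ) (a : V) : Function.Injective (dPVal n a) :=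
  (toFull_injective _ _).comp Subtype.val_injective

theorem exists_bd_eq_dPVal {n : ℕ} {a : V} (x : (dP V n).obj (op a)) :
    ∃ z ∈ Finsupp.supported ℤ ℤ (simplices (Set.Ici a) (n + 1)), bd V z = dPVal n a x := by
  obtain ⟨_, c, rfl⟩ := x
  rw [← faceSet_tail, ← range_toFull]
  exact ⟨_, ⟨c, rfl⟩, (toFull_boundary _ _ c).symm⟩

theorem exists_dPVal_eq_bd {n : ℕ} {a : V} {z : Finset V →₀ ℤ}
    (hz : z ∈ Finsupp.supported ℤ ℤ (simplices (Set.Ici a) (n + 1))) :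
    ∃ x, dPVal n a x = bd V z := by
  rw [← faceSet_tail, ← range_toFull] at hz
  obtain ⟨c, rfl⟩ := hz
  exact ⟨⟨_, c, rfl⟩, toFull_boundary _ _ c⟩

theorem dPVal_map {n : ℕ} {a b : V} (h : a ≤ b) (x : (dP V n).obj (op b)) :
    dPVal n a (((dP V n).map (homOfLE h).op).hom x) = dPVal n b x :=
  toFull_chainsIncl (tail_antitone h) n x.1

/-- The value of an element of the disjoint union of the terms of `d_n P_n`. -/
noncomputable def sigmaVal (n : ℕ) (b : Σ a : V, (dP V n).obj (op a)) : Finset V →₀ ℤ :=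
  dPVal n b.1 b.2

theorem eq_sum_iff {n : ℕ} {B : Set (Σ a : V, (dP V n).obj (op a))} {a : V}
    (x : (dP V n).obj (op a)) (c : {b : Σ j : V, (dP V n).obj (op j) // b ∈ B ∧ a ≤ b.1} →₀ ℤ) :
    (x = c.sum fun b k => k • ((dP V n).map (homOfLE b.2.2).op).hom b.1.2) ↔
      Finsupp.linearCombination ℤ (fun b : {b // b ∈ B ∧ a ≤ b.1} => sigmaVal n b.1) c =
        dPVal n a x := by
  rw [← (dPVal_injective n a).eq_iff, Finsupp.sum, map_sum, Finsupp.linearCombination_apply,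
    Finsupp.sum, eq_comm]
  refine Eq.congr_left (Finset.sum_congr rfl fun b _ => ?_)
  rw [map_zsmul, dPVal_map]
  rfl

theorem isBasis_iff (n : ℕ) (B : Set (Σ a : V, (dP V n).obj (op a))) :
    IsBasis (dP V n) B ↔ LinearIndepOn ℤ (sigmaVal n) B ∧
      ∀ a, ∀ z ∈ Finsupp.supported ℤ ℤ (simplices (Set.Ici a) (n + 1)),
        bd V z ∈ Submodule.span ℤ (sigmaVal n '' {b | b ∈ B ∧ a ≤ b.1}) := by
  simp only [IsBasis, eq_sum_iff]
  have hspan : ∀ a (z : Finset V →₀ ℤ),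
      z ∈ Submodule.span ℤ (sigmaVal n '' {b | b ∈ B ∧ a ≤ b.1}) ↔
        ∃ c, Finsupp.linearCombination ℤ
          (fun b : {b // b ∈ B ∧ a ≤ b.1} => sigmaVal n b.1) c = z := fun a z => by
    rw [Set.image_eq_range, Finsupp.mem_span_range_iff_exists_finsupp]
    rfl
  constructor
  · intro h
    constructor
    -- Uniqueness is given only term by term. Since the order is linear, `B` is a directed union of
    -- its parts above the various `a`, so independence passes to all of `B`.
    · have hB : B = ⋃ a, {b | b ∈ B ∧ a ≤ b.1} := by
        ext b
        simp only [Set.mem_iUnion]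
        exact ⟨fun hb => ⟨b.1, hb, le_rfl⟩, fun ⟨a, hb⟩ => hb.1⟩
      rw [hB]
      refine linearIndepOn_iUnion_of_directed ?_ fun a => ?_
      · intro a a'
        exact ⟨min a a', fun b hb => ⟨hb.1, (min_le_left a a').trans hb.2⟩,
          fun b hb => ⟨hb.1, (min_le_right a a').trans hb.2⟩⟩
      · refine linearIndependent_iff.2 fun c hc => ?_
        exact (h a 0).unique (hc.trans (map_zero _).symm)
          ((map_zero _).trans (map_zero _).symm)
    · intro a z hz
      obtain ⟨x, hx⟩ := exists_dPVal_eq_bd hz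
      obtain ⟨c, hc, -⟩ := h a x
      exact (hspan a _).2 ⟨c, hc.trans hx⟩
  · rintro ⟨hli, hsp⟩ a x
    obtain ⟨z, hz, hzx⟩ := exists_bd_eq_dPVal x
    obtain ⟨c, hc⟩ := (hspan a _).1 (hsp a z hz)
    refine ⟨c, hc.trans hzx, fun c' hc' => ?_⟩
    have := hli.mono (t := {b | b ∈ B ∧ a ≤ b.1}) fun b hb => hb.1
    exact LinearIndependent.finsuppLinearCombination_injective this
      (hc'.trans (hc.trans hzx).symm)

/-- Each basis element is lifted to an `n`-chain in its own tail. Extending linearly gives a section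
`σ` of the boundary map, and `φ` is `σ` after the boundary. -/
theorem exists_isTailSplitting_of_isFree {n : ℕ} (h : IsFree (dP V n)) :
    ∃ φ, IsTailSplitting n (Set.univ : Set V) φ := by
  classical
  obtain ⟨B, hB⟩ := h
  obtain ⟨hli, hsp⟩ := (isBasis_iff n B).1 hB
  have hlift := fun b : Σ a : V, (dP V n).obj (op a) => exists_bd_eq_dPVal b.2
  choose l hl hbd using hlift
  set D := Submodule.span ℤ (Set.range fun b : B => sigmaVal n b.1)
  have hsub : ∀ a, Submodule.span ℤ (sigmaVal n '' {b | b ∈ B ∧ a ≤ b.1}) ≤ D := by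
    intro a
    refine Submodule.span_mono ?_
    rintro _ ⟨b, hb, rfl⟩
    exact ⟨⟨b, hb.1⟩, rfl⟩
  have hmem : ∀ z ∈ Finsupp.supported ℤ ℤ (simplices (Set.univ : Set V) (n + 1)),
      bd V z ∈ D := by
    refine fun z hz => map_mem_of_single _ (bd V) (fun s hs => ?_) hz
    have hne : s.Nonempty := Finset.card_pos.1 (by rw [hs.1]; omega)
    exact hsub _ (hsp (s.min' hne) _ (single_mem ⟨hs.1, fun y hy => s.min'_le y hy⟩))
  let σ : D →ₗ[ℤ] (Finset V →₀ ℤ) :=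
    Finsupp.linearCombination ℤ (fun b : B => l b.1) ∘ₗ LinearIndependent.repr hli
  let φ : (Finset V →₀ ℤ) →ₗ[ℤ] (Finset V →₀ ℤ) :=
    σ ∘ₗ ((bd V ∘ₗ Submodule.subtype _).codRestrict D fun z => hmem z.1 z.2) ∘ₗ
      Finsupp.restrictDom ℤ ℤ (simplices (Set.univ : Set V) (n + 1))
  have hφ : ∀ z (hz : z ∈ Finsupp.supported ℤ ℤ (simplices (Set.univ : Set V) (n + 1))),
      φ z = σ ⟨bd V z, hmem z hz⟩ := by
    intro z hz
    have : Finsupp.restrictDom ℤ ℤ (simplices (Set.univ : Set V) (n + 1)) z = ⟨z, hz⟩ :=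
      LinearMap.congr_fun (Finsupp.restrictDom_comp_subtype (M := ℤ) (R := ℤ)
        (simplices (Set.univ : Set V) (n + 1))) ⟨z, hz⟩
    simp only [φ, LinearMap.comp_apply, this]
    rfl
  have hσbd : ∀ y : D, bd V (σ y) = y := by
    intro y
    have h1 : bd V ∘ₗ Finsupp.linearCombination ℤ (fun b : B => l b.1) =
        Finsupp.linearCombination ℤ (fun b : B => sigmaVal n b.1) := by
      refine Finsupp.lhom_ext' fun b => LinearMap.ext_ring ?_
      simp [hbd, sigmaVal]
    exact (LinearMap.congr_fun h1 _).trans (LinearIndependent.linearCombination_repr hli y)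
  -- Here the basis property on each tail enters: a boundary from `[a, →)` uses only basis elements
  -- indexed above `a`, whose lifts lie in `[a, →)`.
  have hσtail : ∀ a (y : D), y.1 ∈ Submodule.span ℤ (sigmaVal n '' {b | b ∈ B ∧ a ≤ b.1}) →
      σ y ∈ Finsupp.supported ℤ ℤ (simplices (Set.Ici a) (n + 1)) := by
    intro a y hy
    have h1 : Submodule.span ℤ (sigmaVal n '' {b | b ∈ B ∧ a ≤ b.1}) ≤
        ((Finsupp.supported ℤ ℤ (simplices (Set.Ici a) (n + 1))).comap σ).map D.subtype := by
      rw [Submodule.span_le]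
      rintro _ ⟨b, hb, rfl⟩
      refine ⟨⟨sigmaVal n b, Submodule.subset_span ⟨⟨b, hb.1⟩, rfl⟩⟩, ?_, rfl⟩
      have h2 : σ ⟨sigmaVal n b, Submodule.subset_span ⟨⟨b, hb.1⟩, rfl⟩⟩ = l b := by
        simp only [σ, LinearMap.comp_apply]
        rw [LinearIndependent.repr_eq_single hli ⟨b, hb.1⟩ _ rfl]
        simp
      rw [SetLike.mem_coe, Submodule.mem_comap, h2]
      exact Finsupp.supported_mono (simplices_mono (Set.Ici_subset_Ici.2 hb.2) _) (hl b)
    obtain ⟨y', hy', he⟩ := h1 hy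
    rwa [← Subtype.ext he]
  refine ⟨φ, fun a s hs => ?_, fun z hz => ?_, fun z hz => ?_⟩
  · rw [Set.univ_inter] at hs ⊢
    rw [hφ _ (single_mem (simplices_mono (Set.subset_univ _) _ hs))]
    exact hσtail a _ (hsp a _ (single_mem hs))
  · rw [hφ z hz, hσbd]
  · rw [hφ _ (bd_mem hz)]
    simp only [bd_bd]
    exact map_zero σ

/-- For `x ∈ s`, removing another vertex leaves a face containing `x` that occurs in the common
boundary, so `x ∈ t`. This needs `1 ≤ n`: in dimension `0` all vertices have the same boundary. -/
theorem bd_single_injOn {n : ℕ} (hn : 1 ≤ n) :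
    Set.InjOn (fun s => bd V (Finsupp.single s 1)) {s : Finset V | s.card = n + 1} := by
  intro s hs t ht hst
  refine Finset.eq_of_subset_of_card_le (fun x hx => ?_) (by rw [hs.out, ht.out])
  obtain ⟨y, hy, hyx⟩ := s.exists_mem_ne (by rw [hs.out]; omega) x
  have h1 := bd_single_apply_erase hy
  have h2 : bd V (Finsupp.single t 1) (s.erase y) ≠ 0 := by
    rw [← show bd V (Finsupp.single s 1) = bd V (Finsupp.single t 1) from hst, h1]
    exact sgn_ne_zero _ _
  obtain ⟨t', rfl, ht'⟩ := exists_subset_of_bd_apply_ne_zero (single_mem (Set.mem_singleton t)) h2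
  exact ht' (Finset.mem_erase.2 ⟨hyx.symm, hx⟩)

theorem sigmaVal_dGen (n : ℕ) (s : {s : Finset V // s.card = n + 1}) :
    sigmaVal n (dGen n s) = bd V (Finsupp.single s.1 1) := by
  refine (toFull_boundary _ n (Finsupp.single (topFace s) 1)).trans ?_
  rw [toFull_single]
  rfl

theorem isBasis_image_dGen_iff {n : ℕ} (hn : 1 ≤ n) (B : Set {s : Finset V // s.card = n + 1}) :
    IsBasis (dP V n) (dGen n '' B) ↔ IsTailBasis n Set.univ Set.univ (Subtype.val '' B) := by
  have hcomp : sigmaVal n ∘ dGen n =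
      (fun s : Finset V => bd V (Finsupp.single s 1)) ∘ Subtype.val :=
    funext (sigmaVal_dGen n)
  have hinj : Function.Injective (dGen (V := V) n) := by
    intro s t hst
    refine Subtype.ext (bd_single_injOn hn s.2 t.2 ?_)
    change bd V _ = bd V _
    rw [← sigmaVal_dGen, ← sigmaVal_dGen, hst]
  have hLI : LinearIndepOn ℤ (sigmaVal n) (dGen n '' B) ↔
      ∀ z ∈ Finsupp.supported ℤ ℤ (Subtype.val '' B), bd V z = 0 → z = 0 := by
    have himage : LinearIndepOn ℤ (sigmaVal n) (dGen n '' B) ↔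
        LinearIndepOn ℤ (fun s : Finset V => bd V (Finsupp.single s 1)) (Subtype.val '' B) := by
      refine ⟨fun h => LinearIndepOn.image_of_comp _ _ ?_,
        fun h => LinearIndepOn.image_of_comp _ _ ?_⟩
      · exact hcomp ▸ h.comp_of_image hinj.injOn
      · exact hcomp ▸ h.comp_of_image Subtype.val_injective.injOn
    rw [himage, linearIndepOn_iff]
    have : Finsupp.linearCombination ℤ (fun s : Finset V => bd V (Finsupp.single s 1)) = bd V := by
      refine Finsupp.lhom_ext' fun b => LinearMap.ext_ring ?_
      simp
    rw [this]
  have hset : ∀ a : V, sigmaVal n '' {b | b ∈ dGen n '' B ∧ a ≤ b.1} =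
      (fun s : Finset V => bd V (Finsupp.single s 1)) ''
        {t ∈ Subtype.val '' B | (t : Set V) ⊆ Set.Ici a} := by
    intro a
    ext z
    constructor
    · rintro ⟨_, ⟨⟨s, hs, rfl⟩, ha⟩, rfl⟩
      exact ⟨s.1, ⟨⟨s, hs, rfl⟩, fun y hy => ha.trans (s.1.min'_le y hy)⟩,
        (sigmaVal_dGen n s).symm⟩
    · rintro ⟨_, ⟨⟨s, hs, rfl⟩, ha⟩, rfl⟩
      exact ⟨dGen n s, ⟨⟨s, hs, rfl⟩, ha (s.1.min'_mem (Finset.card_pos.1 (by rw [s.2]; omega)))⟩, sigmaVal_dGen n s⟩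
  have hspan : ∀ a : V, Submodule.span ℤ (sigmaVal n '' {b | b ∈ dGen n '' B ∧ a ≤ b.1}) =
      (Finsupp.supported ℤ ℤ {t ∈ Subtype.val '' B | (t : Set V) ⊆ Set.Ici a}).map (bd V) := by
    intro a
    rw [hset, Finsupp.supported_eq_span_single, Submodule.map_span, Set.image_image]
  rw [isBasis_iff, hLI]
  simp only [hspan]
  constructor
  · rintro ⟨h1, h2⟩
    refine ⟨?_, h1, fun a _ s hs => ?_⟩
    · rintro _ ⟨s, -, rfl⟩
      exact ⟨s.2, Set.subset_univ _⟩
    · rw [Set.univ_inter] at hs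
      exact h2 a _ (single_mem hs)
  · refine fun h => ⟨h.inj, fun a z hz => map_mem_of_single _ (bd V) (fun s hs => ?_) hz⟩
    exact h.span a (Set.mem_univ a) s (by rwa [Set.univ_inter])

end Bases

end TailAcyclic

namespace TailAcyclic

universe v

/-! ### Tail bases and tail-acyclic complexes -/

section Complexes

variable {V : Type v}

/-- The complex whose faces are the nonempty sets of at most `n` vertices and the members
of `B`. -/
def skeletonAdjoin (n : ℕ) (hn : 1 ≤ n) (B : Set {s : Finset V // s.card = n + 1}) :
    AbstractSimplicialComplex V where
  faces := {t | t.Nonempty ∧ (t.card ≤ n ∨ t ∈ Subtype.val '' B)}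
  isRelLowerSet_faces := by
    rintro s ⟨hs, hB⟩
    refine ⟨hs, fun t hts ht => ⟨ht, ?_⟩⟩
    by_cases hcard : t.card ≤ n
    · exact Or.inl hcard
    · right
      have hle : s.card ≤ t.card := by
        rcases hB with h | ⟨s, -, rfl⟩
        · exact absurd ((Finset.card_le_card hts).trans h) hcard
        · rw [s.2]; omega
      obtain rfl := Finset.eq_of_subset_of_card_le hts hle
      exact hB.resolve_left hcard
  singleton_mem x := ⟨Finset.singleton_nonempty x, Or.inl (by simpa using hn)⟩

theorem nFaces_skeletonAdjoin {n : ℕ} (hn : 1 ≤ n) (B : Set {s : Finset V // s.card = n + 1}) :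
    nFaces n (skeletonAdjoin n hn B) = B := by
  ext s
  constructor
  · rintro ⟨-, h | h⟩
    · exact absurd h (by rw [s.2]; omega)
    · obtain ⟨t, ht, hts⟩ := h
      rwa [← Subtype.ext hts]
  · exact fun h => ⟨Finset.card_pos.1 (by rw [s.2]; omega), Or.inr ⟨s, h, rfl⟩⟩

theorem faceSet_restrict_subset (K : PreAbstractSimplicialComplex V) (A : Set V) (m : ℕ) :
    faceSet (restrict K A) m ⊆ simplices A m := by
  rintro s ⟨hs, rfl | h⟩
  · exact ⟨hs, by simp⟩
  · exact ⟨hs, h.2⟩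

variable [LinearOrder V]

theorem IsTailAcyclic.isTailBasis {n : ℕ} (hn : 1 ≤ n) {G : AbstractSimplicialComplex V}
    (h : IsTailAcyclic n G) :
    IsTailBasis n Set.univ Set.univ (Subtype.val '' nFaces n G) where
  subset := by
    rintro _ ⟨s, -, rfl⟩
    exact ⟨s.2, Set.subset_univ _⟩
  inj z hz h0 := by
    rcases isEmpty_or_nonempty V with hV | hV
    · have : (Subtype.val '' nFaces n G : Set (Finset V)) = ∅ := by
        ext s
        simp only [Set.mem_image, Set.mem_empty_iff_false, iff_false, not_exists, not_and]
        rintro ⟨t, ht⟩ -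
        rw [Finset.eq_empty_of_isEmpty t] at ht
        simp at ht
      rw [this, Finsupp.supported_empty] at hz
      exact hz
    -- The finitely many vertices of `z` have a common lower bound, so acyclicity of a single tail
    -- suffices.
    obtain ⟨a, ha⟩ := ((z.support.biUnion id).finite_toSet).bddBelow
    obtain ⟨w, hw, rfl⟩ := (subsingleton_reducedHomology_iff _ _).1 (h.acyclic a n) z (by
      intro s hs
      obtain ⟨s, hsG, rfl⟩ := hz hs
      exact ⟨s.2, Or.inr ⟨hsG, fun y hy => ha (Finset.mem_coe.2
        (Finset.mem_biUnion.2 ⟨s.1, hs, hy⟩))⟩⟩) h0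
    have : faceSet (restrict G.toPreAbstractSimplicialComplex (Set.Ici a)) (n + 2) = ∅ := by
      ext s
      simp only [Set.mem_empty_iff_false, iff_false]
      rintro ⟨hs, rfl | h'⟩
      · simp at hs
      · have := h.dim.1 s h'.1
        omega
    rw [this, Finsupp.supported_empty, Submodule.mem_bot] at hw
    rw [hw, map_zero]
  span a _ s hs := by
    rw [Set.univ_inter] at hs
    obtain ⟨k, rfl⟩ : ∃ k, n = k + 1 := ⟨n - 1, by omega⟩
    obtain ⟨w, hw, hwz⟩ := (subsingleton_reducedHomology_iff _ _).1 (h.acyclic a k)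
      (bd V (Finsupp.single s 1)) (by
        refine Finsupp.supported_mono (fun t ht => ?_) (bd_mem (single_mem hs))
        exact ⟨ht.1, Or.inr ⟨h.complete t ht.1, ht.2⟩⟩) (bd_bd _)
    refine ⟨w, Finsupp.supported_mono ?_ hw, hwz⟩
    rintro t ⟨ht, rfl | ht'⟩
    · simp at ht
    · exact ⟨⟨⟨t, ht⟩, ht'.1, rfl⟩, ht'.2⟩

theorem IsTailBasis.isTailAcyclic {n : ℕ} (hn : 1 ≤ n) {B : Set {s : Finset V // s.card = n + 1}}
    (h : IsTailBasis n Set.univ Set.univ (Subtype.val '' B)) :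
    IsTailAcyclic n (skeletonAdjoin n hn B) where
  dim := by
    refine ⟨?_, ?_⟩
    · rintro s ⟨-, hs | ⟨s, -, rfl⟩⟩
      · omega
      · exact s.2.le
    · rintro ⟨s⟩
      rw [nFaces_skeletonAdjoin]
      have hne : s.1.Nonempty := Finset.card_pos.1 (by rw [s.2]; omega)
      obtain ⟨x, hx⟩ := hne
      obtain ⟨w, hw, hws⟩ := h.span (s.1.min' ⟨x, hx⟩) (Set.mem_univ _) s.1
        ⟨s.2, by rw [Set.univ_inter]; exact fun y hy => s.1.min'_le y hy⟩
      -- Boundaries of simplices are nonzero, so a spanning `B` cannot be empty.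
      have h1 : bd V w (s.1.erase x) ≠ 0 := by
        rw [hws, bd_single_apply_erase hx]; exact sgn_ne_zero _ _
      obtain ⟨_, ⟨⟨t, ht, -⟩, -⟩, -⟩ := exists_subset_of_bd_apply_ne_zero hw h1
      exact ⟨t, ht⟩
  complete s hs := ⟨Finset.card_pos.1 (by omega), Or.inl hs.le⟩
  acyclic a k := by
    rw [subsingleton_reducedHomology_iff]
    intro z hz h0
    have hz' := Finsupp.supported_mono (faceSet_restrict_subset _ _ _) hz
    -- Below degree `n`, a cycle is filled in the complete complex on the tail; when `k + 1 = n`,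
    -- the spanning property replaces the filling by one on `B`. Degree `n` is independence, and
    -- above it there are no faces.
    rcases lt_trichotomy k n with hk | rfl | hk
    · obtain ⟨w, hw, rfl⟩ := exists_bd_eq hz' h0
      rcases Nat.lt_or_ge (k + 1) n with hk' | hk'
      · refine ⟨w, Finsupp.supported_mono (fun t ht => ?_) hw, rfl⟩
        have hcard := ht.1
        exact ⟨ht.1, Or.inr ⟨⟨Finset.card_pos.1 (by omega), Or.inl (by omega)⟩, ht.2⟩⟩
      · obtain rfl : n = k + 1 := by omega
        have := map_mem_of_single _ (bd V) (fun s hs => h.span a (Set.mem_univ a) s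
          (by rwa [Set.univ_inter])) hw
        obtain ⟨w', hw', hww'⟩ := this
        refine ⟨w', Finsupp.supported_mono ?_ hw', hww'⟩
        rintro _ ⟨⟨t, ht, rfl⟩, hta⟩
        exact ⟨t.2, Or.inr ⟨⟨Finset.card_pos.1 (by rw [t.2]; omega), Or.inr ⟨t, ht, rfl⟩⟩, hta⟩⟩
    · refine ⟨0, Submodule.zero_mem _, ?_⟩
      rw [map_zero]
      refine (h.inj z (Finsupp.supported_mono ?_ hz) h0).symm
      rintro s ⟨hs, rfl | ⟨⟨-, hs' | hs'⟩, -⟩⟩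
      · simp at hs
      · omega
      · exact hs'
    · refine ⟨0, Submodule.zero_mem _, ?_⟩
      have : faceSet (restrict (skeletonAdjoin n hn B).toPreAbstractSimplicialComplex
          (Set.Ici a)) (k + 1) = ∅ := by
        ext s
        simp only [Set.mem_empty_iff_false, iff_false]
        rintro ⟨hs, rfl | ⟨⟨-, hs' | ⟨s, -, rfl⟩⟩, -⟩⟩
        · simp at hs
        · omega
        · have := s.2
          omega
      rw [this, Finsupp.supported_empty, Submodule.mem_bot] at hz
      rw [hz, map_zero]

/-- If there are more than `n` vertices, then every set of at most `n` vertices is contained in a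
member of a tail basis. -/
theorem IsTailBasis.exists_superset {n : ℕ} {B : Set {s : Finset V // s.card = n + 1}}
    (h : IsTailBasis n Set.univ Set.univ (Subtype.val '' B)) {S : Finset V} (hS : S.card = n + 1)
    {t : Finset V} (ht : t.card ≤ n) : ∃ s ∈ B, t ⊆ s.1 := by
  obtain ⟨r, htr, -, hr⟩ := Finset.exists_subsuperset_card_eq (s := t) (t := t ∪ S) (n := n + 1)
    Finset.subset_union_left (by omega) (hS ▸ Finset.card_le_card Finset.subset_union_right)
  obtain ⟨x, hxr, hxt⟩ : ∃ x ∈ r, x ∉ t := by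
    by_contra! hrt
    have := Finset.card_le_card (show r ⊆ t from hrt)
    omega
  obtain ⟨w, hw, hwr⟩ := h.span (r.min' ⟨x, hxr⟩) (Set.mem_univ _) r
    ⟨hr, by rw [Set.univ_inter]; exact fun y hy => r.min'_le y hy⟩
  have h1 : bd V w (r.erase x) ≠ 0 := by
    rw [hwr, bd_single_apply_erase hxr]; exact sgn_ne_zero _ _
  obtain ⟨_, ⟨⟨s, hs, rfl⟩, -⟩, hrs⟩ := exists_subset_of_bd_apply_ne_zero hw h1
  exact ⟨s, hs, (Finset.subset_erase.2 ⟨htr, hxt⟩).trans hrs⟩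

theorem faces_skeletonAdjoin {n : ℕ} (hn : 1 ≤ n) {B : Set {s : Finset V // s.card = n + 1}}
    (h : IsTailBasis n Set.univ Set.univ (Subtype.val '' B)) {S : Finset V}
    (hS : S.card = n + 1) :
    (skeletonAdjoin n hn B).faces = {t | t.Nonempty ∧ ∃ s ∈ B, t ⊆ s.1} := by
  ext t
  refine and_congr_right fun _ => ⟨?_, ?_⟩
  · rintro (ht | ⟨s, hs, rfl⟩)
    · exact h.exists_superset hS ht
    · exact ⟨s, hs, subset_rfl⟩
  · rintro ⟨s, hs, hts⟩
    by_cases ht : t.card ≤ n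
    · exact Or.inl ht
    · right
      exact ⟨s, hs, (Finset.eq_of_subset_of_card_le hts (by rw [s.2]; omega)).symm⟩

end Complexes

theorem exists_finset_card_eq_of_lt {n : ℕ} {γ : Ordinal.{v}} (h : (n : Ordinal.{v}) < γ) :
    ∃ S : Finset (Set.Iio γ), S.card = n + 1 := by
  let f : Fin (n + 1) → Set.Iio γ := fun i =>
    ⟨(i.1 : Ordinal.{v}), lt_of_le_of_lt (Nat.cast_le.2 (Nat.lt_succ_iff.1 i.2)) h⟩
  have hf : Function.Injective f := fun i j hij =>
    Fin.ext (Nat.cast_injective (congrArg Subtype.val hij))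
  exact ⟨Finset.univ.map ⟨f, hf⟩, by simp⟩

end TailAcyclic

/-! ### Assembly of the three statements -/

theorem mainTheorem3 (n : ℕ) (hn : 1 ≤ n) (γ : Ordinal.{u}) :
    (TailAcyclic.IsFree (TailAcyclic.dP (Set.Iio γ) n) ↔
      ∃ G : AbstractSimplicialComplex (Set.Iio γ), TailAcyclic.IsTailAcyclic n G) ∧
    (∀ G : AbstractSimplicialComplex (Set.Iio γ), TailAcyclic.IsTailAcyclic n G →
      TailAcyclic.IsBasis (TailAcyclic.dP (Set.Iio γ) n)
        (TailAcyclic.dGen n '' TailAcyclic.nFaces n G)) ∧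
    (∀ B : Set {s : Finset (Set.Iio γ) // s.card = n + 1},
      TailAcyclic.IsBasis (TailAcyclic.dP (Set.Iio γ) n) (TailAcyclic.dGen n '' B) →
      ∃ G : AbstractSimplicialComplex (Set.Iio γ), TailAcyclic.IsTailAcyclic n G ∧
        TailAcyclic.nFaces n G = B ∧
        ((n : Ordinal.{u}) < γ →
          G.faces = {t | t.Nonempty ∧ ∃ s ∈ B, t ⊆ s.1})) := by
  have hbasis : ∀ G : AbstractSimplicialComplex (Set.Iio γ), TailAcyclic.IsTailAcyclic n G →
      TailAcyclic.IsBasis (TailAcyclic.dP (Set.Iio γ) n)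
        (TailAcyclic.dGen n '' TailAcyclic.nFaces n G) := fun G hG =>
    (TailAcyclic.isBasis_image_dGen_iff hn _).2 (hG.isTailBasis hn)
  refine ⟨⟨fun h => ?_, fun ⟨G, hG⟩ => ⟨_, hbasis G hG⟩⟩, hbasis, fun B hB => ?_⟩
  · obtain ⟨φ, hφ⟩ := TailAcyclic.exists_isTailSplitting_of_isFree h
    obtain ⟨C, hCX, hC, hcard⟩ := hφ.exists_cofinal n
    obtain ⟨B, hB⟩ := TailAcyclic.exists_isTailBasis n Set.univ C hCX hC hcard
    -- `B` contains only sets of `n + 1` elements, so passing to the subtype loses nothing.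
    have himage : Subtype.val '' {s : {s : Finset (Set.Iio γ) // s.card = n + 1} | s.1 ∈ B} = B :=
      Subtype.image_preimage_coe _ _ |>.trans
        (Set.inter_eq_right.2 fun s hs => (hB.subset hs).1)
    rw [← himage] at hB
    exact ⟨_, hB.isTailAcyclic hn⟩
  · have hB' := (TailAcyclic.isBasis_image_dGen_iff hn B).1 hB
    refine ⟨_, hB'.isTailAcyclic hn, TailAcyclic.nFaces_skeletonAdjoin hn B, fun hγ => ?_⟩
    obtain ⟨S, hS⟩ := TailAcyclic.exists_finset_card_eq_of_lt hγ
    exact TailAcyclic.faces_skeletonAdjoin hn hB' hS
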